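/- Let $d\ge 2$. Integrals over the unit sphere $S=S^{d-1}$ are with respect to the rotation-invariant probability measure, $\hat f(\xi)=\int f(x)e^{-2\pi i x\cdot\xi}\,dx$, and $\mathcal S_{\mathrm{rad}}(\mathbb R^p)$ is the space of complex-valued radial Schwartz functions on $\mathbb R^p$; for radial $g$ and $r\ge0$, $g(r)$ denotes the value of $g$ on $\{|y|=r\}$. Let $\mathcal H_m(\mathbb R^d)$ be the space of complex harmonic polynomials on $\mathbb R^d$ that are homogeneous of degree $m$. For $\omega\in\mathbb R^d$ let $Z_m^d(\cdot,\omega)\in\mathcal H_m(\mathbb R^d)$ be the zonal harmonic, i.e. the unique element with $\int_S u(\zeta)\overline{Z_m^d(\zeta,\omega)}\,d\zeta=u(\omega)$ for all $u\in\mathcal H_m(\mathbb R^d)$. Let $(r_n)_{n\ge0}$ and $(\rho_n)_{n\ge0}$ be sequences of non-negative real numbers. Suppose that for each $p\in\{d+2m: m\in\mathbb N_0\}$, each real $r\ge0$ and each $n\in\mathbb N_0$ we are given complex numbers $c_{p,n}(r),\tilde c_{p,n}(r)$ such that, for all such $p$, all $g\in\mathcal S_{\mathrm{rad}}(\mathbb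 R^p)$ and all $y\in\mathbb R^p$, $$g(y)=\sum_{n=0}^\infty c_{p,n}(|y|)\,g(r_n)+\sum_{n=0}^\infty\tilde c_{p,n}(|y|)\,\hat g(\rho_n),$$ where both series converge (not necessarily absolutely). Then for every $f\in\mathcal S(\mathbb R^d)$ and every $x\in\mathbb R^d$, $$f(x)=\sum_{m=0}^\infty\left(\sum_{n=0}^\infty\Big(c_{d+2m,n}(|x|)\int_S f(r_n\zeta)Z_m^d(x,\zeta/r_n)\,d\zeta+i^m\,\tilde c_{d+2m,n}(|x|)\int_S\hat f(\rho_n\zeta)Z_m^d(x,\zeta/\rho_n)\,d\zeta\Big)\right).$$ Here each inner series over $n$ converges (not necessarily absolutely) to some $s_m\in\mathbb C$, one has $\sum_{m=0}^\infty|s_m|<\infty$, and $\sum_{m=0}^\infty s_m=f(x)$. When $r_n=0$, the integral $\int_S f(r_n\zeta)Z_m^d(x,\zeta/r_n)\,d\zeta$ is defined to be $$\sum_{|\alpha|=m}\frac{(\partial^\alpha f)(0)}{\alpha!}\int_S\zeta^\alpha Z_m^d(x,\zeta)\,d\zeta,$$ and likewise with $\hat f$ in place of $f$ when $\rho_n=0$.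 -/

import Mathlib

open MeasureTheory Filter Topology FourierTransform SchwartzMap

noncomputable section

namespace RadialInterp

/-- Euclidean space `ℝ^d`. -/
abbrev E (d : ℕ) : Type := EuclideanSpace ℝ (Fin d)

/-- The unit sphere `S^{d-1}` in `ℝ^d`. -/
abbrev S (d : ℕ) : Type := Metric.sphere (0 : E d) 1

/-- The rotation invariant probability measure on `S^{d-1}`: normalized surface measure. -/
def sphereMeasure (d : ℕ) : Measure (S d) :=
  ((volume : Measure (E d)).toSphere Set.univ)⁻¹ • (volume : Measure (E d)).toSphere

/-! ### Harmonic polynomials and zonal harmonics -/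

/-- The Laplacian `∑ i, ∂_i ∂_i` on polynomials in `d` variables. -/
def polyLaplacian (d : ℕ) : MvPolynomial (Fin d) ℂ →ₗ[ℂ] MvPolynomial (Fin d) ℂ :=
  ∑ i : Fin d,
    (MvPolynomial.pderiv (R := ℂ) i).toLinearMap ∘ₗ (MvPolynomial.pderiv (R := ℂ) i).toLinearMap

/-- The space `𝓗_m(ℝ^d)` of complex harmonic polynomials on `ℝ^d`, homogeneous of degree `m`. -/
def harmonicPoly (d m : ℕ) : Submodule ℂ (MvPolynomial (Fin d) ℂ) :=
  MvPolynomial.homogeneousSubmodule (Fin d) ℂ m ⊓ LinearMap.ker (polyLaplacian d)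

theorem mem_harmonicPoly {d m : ℕ} (P : MvPolynomial (Fin d) ℂ) :
    P ∈ harmonicPoly d m ↔ P.IsHomogeneous m ∧
      ∑ i : Fin d, MvPolynomial.pderiv i (MvPolynomial.pderiv i P) = 0 := by
  simp [harmonicPoly, polyLaplacian, MvPolynomial.mem_homogeneousSubmodule]

/-- The value of a polynomial at a point of `ℝ^d`, as a linear form in the polynomial. -/
def evalAt {d : ℕ} (x : E d) : MvPolynomial (Fin d) ℂ →ₗ[ℂ] ℂ :=
  (MvPolynomial.aeval (fun i => (x i : ℂ))).toLinearMap

theorem evalAt_apply {d : ℕ} (x : E d) (P : MvPolynomial (Fin d) ℂ) :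
    evalAt x P = MvPolynomial.eval (fun i => (x i : ℂ)) P := by
  simp [evalAt, MvPolynomial.aeval_eq_eval]

theorem continuous_evalAt {d : ℕ} (P : MvPolynomial (Fin d) ℂ) :
    Continuous fun x : E d => evalAt x P := by
  simp only [evalAt_apply]
  refine (MvPolynomial.continuous_eval P).comp ?_
  fun_prop

theorem evalAt_smul {d m : ℕ} {P : MvPolynomial (Fin d) ℂ} (hP : P.IsHomogeneous m)
    (t : ℝ) (x : E d) : evalAt (t • x) P = (t : ℂ) ^ m * evalAt x P := by
  simp only [evalAt_apply, PiLp.smul_apply, smul_eq_mul, Complex.ofReal_mul]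
  rw [MvPolynomial.eval_eq, MvPolynomial.eval_eq, Finset.mul_sum]
  refine Finset.sum_congr rfl fun a ha => ?_
  have h1 : ∑ i ∈ a.support, a i = m := by
    have := hP (MvPolynomial.mem_support_iff.mp ha)
    simpa [Finsupp.weight_apply, Finsupp.sum] using this
  simp only [mul_pow, Finset.prod_mul_distrib, Finset.prod_pow_eq_pow_sum, h1]
  ring

instance sphereMeasure_finite (d : ℕ) : IsFiniteMeasure (sphereMeasure d) := by
  by_cases h : (volume : Measure (E d)).toSphere Set.univ = 0
  · have : (volume : Measure (E d)).toSphere = 0 := Measure.measure_univ_eq_zero.mp h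
    constructor
    simp [sphereMeasure, this]
  · constructor
    simp only [sphereMeasure, Measure.smul_apply, smul_eq_mul]
    exact ENNReal.mul_lt_top (ENNReal.inv_lt_top.mpr (pos_iff_ne_zero.mpr h))
      (measure_lt_top _ _)

theorem sphereMeasure_univ {d : ℕ} (hd : 2 ≤ d) : sphereMeasure d Set.univ = 1 := by
  have : Nonempty (Fin d) := ⟨⟨0, by omega⟩⟩
  have h : (volume : Measure (E d)).toSphere Set.univ ≠ 0 := by
    rw [Measure.toSphere_apply_univ]
    simp only [finrank_euclideanSpace, Fintype.card_fin]
    exact mul_ne_zero (by exact_mod_cast (by omega : d ≠ 0))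
      (Metric.measure_ball_pos _ _ one_pos).ne'
  simp only [sphereMeasure, Measure.smul_apply, smul_eq_mul]
  exact ENNReal.inv_mul_cancel h (measure_ne_top _ _)

instance sphereMeasure_openPos (d : ℕ) : (sphereMeasure d).IsOpenPosMeasure := by
  refine Measure.IsOpenPosMeasure.mk fun U hU hne => ?_
  simp only [sphereMeasure, Measure.smul_apply, smul_eq_mul]
  exact mul_ne_zero (ENNReal.inv_ne_zero.mpr (measure_ne_top _ _)) (hU.measure_ne_zero _ hne)

theorem integrable_sphere {d : ℕ} {f : S d → ℂ} (hf : Continuous f) :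
    Integrable f (sphereMeasure d) :=
  hf.integrable_of_hasCompactSupport (HasCompactSupport.of_compactSpace f)

theorem continuous_evalAt_sphere {d : ℕ} (P : MvPolynomial (Fin d) ℂ) :
    Continuous fun ζ : S d => evalAt (ζ : E d) P :=
  (continuous_evalAt P).comp continuous_subtype_val

theorem eq_zero_of_sphere {d m : ℕ} (hd : 2 ≤ d) {P : MvPolynomial (Fin d) ℂ}
    (hP : P.IsHomogeneous m) (h : ∀ ζ : S d, evalAt (ζ : E d) P = 0) : P = 0 := by
  have hne : ∀ x : E d, x ≠ 0 → evalAt x P = 0 := by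
    intro x hx
    have hx' : ‖x‖ ≠ 0 := norm_ne_zero_iff.mpr hx
    have h1 := h ⟨‖x‖⁻¹ • x, by simp [norm_smul, hx']⟩
    have h2 := evalAt_smul hP ‖x‖ (‖x‖⁻¹ • x)
    rwa [smul_smul, mul_inv_cancel₀ hx', one_smul, h1, mul_zero] at h2
  refine MvPolynomial.funext_set (fun _ => ((↑) : ℝ → ℂ) '' Set.Ioi 0)
    (fun _ => (Set.Ioi_infinite 0).image Complex.ofReal_injective.injOn) ?_
  intro y hy
  choose z hz hzy using fun i => hy i (Set.mem_univ i)
  have h3 := hne (WithLp.toLp 2 z) (by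
    intro h0
    have h4 := congrArg (fun v : E d => v ⟨0, by omega⟩) h0
    have h5 := hz ⟨0, by omega⟩
    simp only [Set.mem_Ioi] at h5
    simp at h4
    linarith)
  rw [evalAt_apply] at h3
  simp only [hzy] at h3
  simpa using h3

/-- The inner product `⟨u, v⟩ = ∫_{S^{d-1}} conj(u) v` on `𝓗_m(ℝ^d)`. -/
@[reducible]
def harmonicCore {d : ℕ} (hd : 2 ≤ d) (m : ℕ) :
    InnerProductSpace.Core ℂ (harmonicPoly d m) where
  inner u v := ∫ ζ : S d, starRingEnd ℂ (evalAt (ζ : E d) u) * evalAt (ζ : E d) v ∂sphereMeasure d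
  conj_inner_symm u v := by
    rw [← integral_conj]
    simp [mul_comm]
  re_inner_nonneg u := by
    have : ∀ z : ℂ, starRingEnd ℂ z * z = ((‖z‖ ^ 2 : ℝ) : ℂ) := fun z => by
      rw [Complex.conj_mul']; simp
    simp only [this]
    rw [integral_complex_ofReal]
    exact integral_nonneg fun ζ => by positivity
  add_left u v w := by
    simp only [Submodule.coe_add, map_add, add_mul]
    refine integral_add (integrable_sphere ?_) (integrable_sphere ?_) <;>
    exact (Complex.continuous_conj.comp (continuous_evalAt_sphere _)).mul
      (continuous_evalAt_sphere _)
  smul_left u v a := by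
    simp only [Submodule.coe_smul, map_smul, smul_eq_mul, map_mul, mul_assoc]
    exact integral_const_mul _ _
  definite u hu := by
    have : ∀ z : ℂ, starRingEnd ℂ z * z = ((‖z‖ ^ 2 : ℝ) : ℂ) := fun z => by
      rw [Complex.conj_mul']; simp
    simp only [this] at hu
    rw [integral_complex_ofReal, Complex.ofReal_eq_zero] at hu
    have hc : Continuous fun ζ : S d => ‖evalAt (ζ : E d) (u : MvPolynomial (Fin d) ℂ)‖ ^ 2 :=
      (continuous_evalAt_sphere _).norm.pow 2
    rw [integral_eq_zero_iff_of_nonneg (fun ζ => by positivity)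
      (hc.integrable_of_hasCompactSupport (HasCompactSupport.of_compactSpace _)),
      hc.ae_eq_iff_eq _ continuous_zero] at hu
    refine Subtype.ext (eq_zero_of_sphere hd u.2.1 fun ζ => ?_)
    simpa using congrFun hu ζ

instance harmonicPoly_finite (d m : ℕ) : FiniteDimensional ℂ (harmonicPoly d m) := by
  have : FiniteDimensional ℂ (MvPolynomial.homogeneousSubmodule (Fin d) ℂ m) :=
    Module.Finite.iff_fg.mpr (MvPolynomial.homogeneousSubmodule_fg (Fin d) ℂ m)
  exact Submodule.finiteDimensional_of_le inf_le_left

/-- The vector representing a linear form for an inner product on a finite-dimensional space. -/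
def rieszVector {V : Type} [AddCommGroup V] [Module ℂ V] [FiniteDimensional ℂ V]
    (cd : InnerProductSpace.Core ℂ V) (φ : V →ₗ[ℂ] ℂ) : V :=
  letI := cd.toNormedAddCommGroup
  letI := InnerProductSpace.ofCore cd.toCore
  haveI : CompleteSpace V := FiniteDimensional.complete ℂ V
  (InnerProductSpace.toDual ℂ V).symm (LinearMap.toContinuousLinearMap φ)

theorem rieszVector_spec {V : Type} [AddCommGroup V] [Module ℂ V] [FiniteDimensional ℂ V]
    (cd : InnerProductSpace.Core ℂ V) (φ : V →ₗ[ℂ] ℂ) (v : V) :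
    cd.inner (rieszVector cd φ) v = φ v := by
  let i1 := cd.toNormedAddCommGroup
  let i2 := InnerProductSpace.ofCore cd.toCore
  have : CompleteSpace V := FiniteDimensional.complete ℂ V
  exact InnerProductSpace.toDual_symm_apply (𝕜 := ℂ) (E := V) (x := v)
    (y := LinearMap.toContinuousLinearMap φ)

/-- The zonal harmonic `Z_m^d(·, ω)` as a harmonic polynomial: the element of `𝓗_m(ℝ^d)` that
represents the evaluation `u ↦ u(ω)` for the inner product of `L²(S^{d-1})`
(see `zonal_spec`). It is defined for every `ω` in `ℝ^d`. -/
def zonalPoly {d : ℕ} (hd : 2 ≤ d) (m : ℕ) (ω : E d) : harmonicPoly d m :=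
  rieszVector (harmonicCore hd m) (evalAt ω ∘ₗ (harmonicPoly d m).subtype)

/-- The zonal harmonic `Z_m^d(x, ω)`, homogeneous of degree `m` in both variables. -/
def zonal {d : ℕ} (hd : 2 ≤ d) (m : ℕ) (x ω : E d) : ℂ :=
  evalAt x (zonalPoly hd m ω : MvPolynomial (Fin d) ℂ)

/-- The reproducing property of the zonal harmonics. -/
theorem zonal_spec {d : ℕ} (hd : 2 ≤ d) (m : ℕ) (ω : E d) (u : harmonicPoly d m) :
    ∫ ζ : S d, evalAt (ζ : E d) (u : MvPolynomial (Fin d) ℂ) *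
      starRingEnd ℂ (zonal hd m ζ ω) ∂sphereMeasure d = evalAt ω u := by
  have h := rieszVector_spec (harmonicCore hd m) (evalAt ω ∘ₗ (harmonicPoly d m).subtype) u
  simp only [LinearMap.comp_apply, Submodule.subtype_apply] at h
  rw [← h]
  exact integral_congr_ae (Eventually.of_forall fun ζ => mul_comm _ _)

/-! ### Spherical integrals, including the radius zero -/

/-- The partial derivative `∂_i f`. -/
def partialD {d : ℕ} (i : Fin d) (f : E d → ℂ) : E d → ℂ :=
  fun x => fderiv ℝ f x (EuclideanSpace.single i 1)

/-- The iterated partial derivative `∂^α f = ∂_0^{α_0} ⋯ ∂_{d-1}^{α_{d-1}} f`. -/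
def multiPartialD {d : ℕ} (α : Fin d → ℕ) (f : E d → ℂ) : E d → ℂ :=
  (List.finRange d).foldr (fun i g => (partialD i)^[α i] g) f

/-- For a kernel `k` homogeneous of degree `m`, the integral `∫_{S} f(rζ) k(ζ/r) dζ` if `r ≠ 0`, and
`∑_{|α| = m} (∂^α f)(0)/α! ∫_{S} ζ^α k(ζ) dζ` if `r = 0`. -/
def sphereIntegral {d : ℕ} (m : ℕ) (f k : E d → ℂ) (r : ℝ) : ℂ :=
  if r = 0 then
    ∑ α ∈ (Finset.univ : Finset (Fin d)).piAntidiag m,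
      multiPartialD α f 0 / ((∏ i, (α i).factorial : ℕ) : ℂ) *
        ∫ ζ : S d, (∏ i, (((ζ : E d) i : ℝ) : ℂ) ^ α i) * k ζ ∂sphereMeasure d
  else ∫ ζ : S d, f (r • (ζ : E d)) * k (r⁻¹ • (ζ : E d)) ∂sphereMeasure d

/-! ### Radial interpolation formulas -/

/-- `∑_{n ≥ 0} a n = s`, the series converging (not necessarily absolutely). -/
def SeriesTo (a : ℕ → ℂ) (s : ℂ) : Prop :=
  Tendsto (fun N => ∑ n ∈ Finset.range N, a n) atTop (𝓝 s)

def IsRadial {p : ℕ} (g : E p → ℂ) : Prop :=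
  ∀ x y : E p, ‖x‖ = ‖y‖ → g x = g y

/-- The point `(r, 0, …, 0)` of `ℝ^p`. -/
def axisPoint (p : ℕ) (r : ℝ) : E p :=
  WithLp.toLp 2 fun i => if (i : ℕ) = 0 then r else 0

theorem norm_axisPoint {p : ℕ} (hp : 1 ≤ p) {r : ℝ} (hr : 0 ≤ r) : ‖axisPoint p r‖ = r := by
  have h : axisPoint p r = EuclideanSpace.single (⟨0, hp⟩ : Fin p) r := by
    ext i
    simp [axisPoint, Fin.ext_iff]
  rw [h, PiLp.norm_single, Real.norm_of_nonneg hr]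

/-- The value at radius `r` of a radial function on `ℝ^p`, `p ≥ 1`. -/
def radialValue {p : ℕ} (g : E p → ℂ) (r : ℝ) : ℂ := g (axisPoint p r)

/-- The radial interpolation formula in dimension `p` with nodes `r_n`, `ρ_n` and coefficients
`c_n`, `c'_n`: for every radial Schwartz function `g` on `ℝ^p` and every `y` one has
`g(y) = ∑ c_n(|y|) g(r_n) + ∑ c'_n(|y|) ĝ(ρ_n)`, both series being convergent. -/
def RadialInterpolation (p : ℕ) (r ρ : ℕ → ℝ) (c c' : ℕ → ℝ → ℂ) : Prop :=
  ∀ g : 𝓢(E p, ℂ), IsRadial g → ∀ y : E p, ∃ A B : ℂ,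
    SeriesTo (fun n => c n ‖y‖ * radialValue g (r n)) A ∧
    SeriesTo (fun n => c' n ‖y‖ * radialValue (𝓕 g : 𝓢(E p, ℂ)) (ρ n)) B ∧
    g y = A + B

end RadialInterp

end

/-!
The formula combines the expansion of `f` in spherical harmonics with Bochner's relation, which
turns the harmonic component of degree `m` of a function on `ℝ^d` into a radial function on
`ℝ^(d + 2m)`.

Let `q` be a harmonic polynomial on `ℝ^d`, homogeneous of degree `m`, and let
`profile m q f r = r^(-m) ∫_S f(rζ) q(ζ) dζ`, which at `r = 0` is read as the pairing of the Taylor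
polynomial of degree `m` with `q`. For Schwartz `f` the function `y ↦ profile m q f ‖y‖` on
`ℝ^(d + 2m)` is a Schwartz function whose Fourier transform is `I ^ m` times the function built in
the same way from `𝓕 f` (`exists_schwartz_radialLift`). To see this, both functions are integrated
against Gaussians. In polar coordinates the integral of the lift against `e^{-b |y|²}` is a
multiple of the integral over `ℝ^d` of `f q` against the same Gaussian, and the Fourier transform of
`q e^{-b |x|²}` is known, because `q` is harmonic. A bounded continuous radial function is
determined by its Gaussian integrals (Weierstrass approximation in the variable `e^{-r²}`), hence the
identity for the Fourier transform. Smoothness of the lift is then a consequence of the rapid decay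
of both functions, a function being smooth when its Fourier transform decays rapidly.

For `q` the zonal harmonic with pole `x`, the radial interpolation formula in dimension `d + 2m`,
applied to this lift at radius `‖x‖`, gives the inner series, with sum
`s_m = ‖x‖^(-m) ∫_S f(‖x‖ζ) Z_m(x, ζ) dζ` (`seriesTo_zonal_component`).

It remains that `∑ s_m = f x` absolutely. The number `s_m` is the value at `x / ‖x‖` of the
projection of `ζ ↦ f(‖x‖ζ)` to the harmonic polynomials of degree `m`. Applying the
Laplace–Beltrami operator repeatedly shows that these projections decay faster than any power of `m`
(`exists_bound_sphere_integral`), while the `L¹` norm of the zonal harmonic is bounded by a power of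
`m` (`integral_norm_zonalPoly_le`). The expansion is therefore uniformly convergent on the sphere;
its sum has the same harmonic components as the function, and so equals it
(`eq_zero_of_orthogonal_harmonics`).
-/

open scoped ContDiff LineDeriv

noncomputable section

namespace RadialInterp

/-! ### A criterion for a function to be a Schwartz function -/

/-- `φ` decays faster than every power of `‖x‖`. -/
def RapidDecay {V F : Type*} [NormedAddCommGroup V] [NormedAddCommGroup F] (φ : V → F) : Prop :=
  ∀ N : ℕ, ∃ C : ℝ, ∀ x, ‖x‖ ^ N * ‖φ x‖ ≤ C

section Criterion

variable {V F : Type*} [NormedAddCommGroup V] [NormedAddCommGroup F]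

theorem RapidDecay.one_add_pow {φ : V → F} (h : RapidDecay φ) (N : ℕ) :
    ∃ C : ℝ, 0 ≤ C ∧ ∀ x, (1 + ‖x‖) ^ N * ‖φ x‖ ≤ C := by
  obtain ⟨C, hC⟩ := h N
  obtain ⟨C0, hC0⟩ := h 0
  have h0 : ∀ x, (1 + ‖x‖) ^ N * ‖φ x‖ ≤ 2 ^ (N - 1) * (C0 + C) := fun x => by
    have h1 := add_pow_le (zero_le_one) (norm_nonneg x) N
    have h2 := hC0 x
    have h3 := hC x
    rw [pow_zero, one_mul] at h2
    calc (1 + ‖x‖) ^ N * ‖φ x‖ ≤ 2 ^ (N - 1) * (1 ^ N + ‖x‖ ^ N) * ‖φ x‖ := by gcongr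
      _ = 2 ^ (N - 1) * (‖φ x‖ + ‖x‖ ^ N * ‖φ x‖) := by ring
      _ ≤ _ := by gcongr
  exact ⟨_, le_trans (by positivity) (h0 0), h0⟩

variable [NormedSpace ℝ V] [NormedSpace ℝ F]

/-- A rapidly decaying function whose derivative is Lipschitz has a rapidly decaying derivative:
compare the increment of `φ` over a step of length `(1 + ‖x‖)⁻ᴺ` with its linear approximation. -/
theorem RapidDecay.fderiv_of_bound {φ : V → F} (h : RapidDecay φ) (hφ : ContDiff ℝ 2 φ)
    {M : ℝ} (hM : ∀ x, ‖fderiv ℝ (fderiv ℝ φ) x‖ ≤ M) : RapidDecay (fderiv ℝ φ) := by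
  have hM0 : 0 ≤ M := (norm_nonneg (fderiv ℝ (fderiv ℝ φ) 0)).trans (hM 0)
  have hd1 : Differentiable ℝ φ := hφ.differentiable (by norm_num)
  have hd2 : Differentiable ℝ (fderiv ℝ φ) :=
    (hφ.fderiv_right (m := 1) (by norm_num)).differentiable (by norm_num)
  have hlip : ∀ x y, ‖fderiv ℝ φ y - fderiv ℝ φ x‖ ≤ M * ‖y - x‖ := fun x y =>
    convex_univ.norm_image_sub_le_of_norm_fderiv_le (𝕜 := ℝ) (fun z _ => hd2 z)
      (fun z _ => hM z) (Set.mem_univ x) (Set.mem_univ y)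
  intro N
  obtain ⟨C, hC0, hC⟩ := h.one_add_pow (2 * N)
  refine ⟨4 ^ N * C + C + M, fun x => ?_⟩
  set δ : ℝ := ((1 + ‖x‖) ^ N)⁻¹ with hδ
  have hx1 : (1 : ℝ) ≤ 1 + ‖x‖ := by linarith [norm_nonneg x]
  have hδ0 : 0 < δ := by positivity
  have hδ1 : δ ≤ 1 := inv_le_one_of_one_le₀ (one_le_pow₀ hx1)
  have hδδ : ((1 + ‖x‖) ^ (2 * N))⁻¹ = δ ^ 2 := by
    rw [hδ, mul_comm, pow_mul, inv_pow]
  have key : ‖fderiv ℝ φ x‖ ≤ (4 ^ N * C + C + M) * δ := by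
    refine ContinuousLinearMap.opNorm_le_of_unit_norm (by positivity) fun v hv => ?_
    have hstep : ‖φ (x + δ • v) - φ x - fderiv ℝ φ x (δ • v)‖ ≤ M * δ * δ := by
      have h1 := (convex_closedBall x δ).norm_image_sub_le_of_norm_fderiv_le' (𝕜 := ℝ)
        (f := φ) (φ := fderiv ℝ φ x) (C := M * δ) (x := x) (y := x + δ • v)
        (fun z _ => hd1 z) (fun z hz => (hlip x z).trans (by
          rw [mem_closedBall_iff_norm] at hz
          gcongr)) (Metric.mem_closedBall_self hδ0.le)
        (by simp [norm_smul, hv, abs_of_pos hδ0])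
      simpa [norm_smul, hv, abs_of_pos hδ0] using h1
    have hz1 : ‖φ x‖ ≤ C * δ ^ 2 := by
      rw [← hδδ, ← div_eq_mul_inv, le_div_iff₀ (by positivity), mul_comm]
      exact hC x
    have hz2 : ‖φ (x + δ • v)‖ ≤ 4 ^ N * C * δ ^ 2 := by
      have h2 : 1 + ‖x‖ ≤ 2 * (1 + ‖x + δ • v‖) := by
        have h3 : ‖x‖ ≤ ‖x + δ • v‖ + δ := by
          have h4 := norm_sub_le (x + δ • v) (δ • v)
          simpa [norm_smul, hv, abs_of_pos hδ0] using h4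
        linarith [norm_nonneg (x + δ • v)]
      rw [← hδδ, ← div_eq_mul_inv, le_div_iff₀ (by positivity)]
      calc ‖φ (x + δ • v)‖ * (1 + ‖x‖) ^ (2 * N)
          ≤ ‖φ (x + δ • v)‖ * (2 * (1 + ‖x + δ • v‖)) ^ (2 * N) := by gcongr
        _ = 4 ^ N * ((1 + ‖x + δ • v‖) ^ (2 * N) * ‖φ (x + δ • v)‖) := by
            rw [mul_pow, pow_mul 2 2 N]; norm_num; ring
        _ ≤ 4 ^ N * C := by gcongr; exact hC _
    have hsum : δ * ‖fderiv ℝ φ x v‖ ≤ δ * ((4 ^ N * C + C + M) * δ) := by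
      have h5 : ‖fderiv ℝ φ x (δ • v)‖ = δ * ‖fderiv ℝ φ x v‖ := by
        rw [map_smul, norm_smul, Real.norm_of_nonneg hδ0.le]
      rw [← h5]
      have h6 : fderiv ℝ φ x (δ • v) = φ (x + δ • v) - φ x -
        (φ (x + δ • v) - φ x - fderiv ℝ φ x (δ • v)) := by abel
      rw [h6]
      refine (norm_sub_le _ _).trans ?_
      have h7 := norm_sub_le (φ (x + δ • v)) (φ x)
      nlinarith
    exact le_of_mul_le_mul_left hsum hδ0
  calc ‖x‖ ^ N * ‖fderiv ℝ φ x‖ ≤ (1 + ‖x‖) ^ N * ((4 ^ N * C + C + M) * δ) := by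
        gcongr; linarith
    _ = 4 ^ N * C + C + M := by
        rw [hδ]; field_simp

end Criterion

/-- A rapidly decaying smooth function all of whose derivatives are bounded is Schwartz. -/
theorem RapidDecay.iteratedFDeriv_of_bound {V : Type} [NormedAddCommGroup V] [NormedSpace ℝ V]
    (k : ℕ) : ∀ {F : Type} [NormedAddCommGroup F] [NormedSpace ℝ F] {φ : V → F},
      RapidDecay φ → ContDiff ℝ ∞ φ → (∀ n, ∃ C, ∀ x, ‖iteratedFDeriv ℝ n φ x‖ ≤ C) →
      ∀ N : ℕ, ∃ C : ℝ, ∀ x, ‖x‖ ^ N * ‖iteratedFDeriv ℝ k φ x‖ ≤ C := by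
  induction k with
  | zero =>
    intro F _ _ φ h _ _ N
    simpa using h N
  | succ k ih =>
    intro F _ _ φ h hφ hb N
    simp only [← norm_iteratedFDeriv_fderiv]
    refine ih ?_ (hφ.fderiv_right (by simp)) (fun n => ?_) N
    · obtain ⟨M, hM⟩ := hb 2
      refine h.fderiv_of_bound (contDiff_infty.1 hφ 2) (M := M) fun x => ?_
      have := hM x
      rwa [← norm_iteratedFDeriv_fderiv, ← norm_iteratedFDeriv_fderiv,
        norm_iteratedFDeriv_zero] at this
    · simpa only [norm_iteratedFDeriv_fderiv] using hb (n + 1)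

theorem RapidDecay.integrable_pow_mul {p : ℕ} {v : E p → ℂ} (hv : RapidDecay v)
    (hm : AEStronglyMeasurable v) (n : ℕ) : Integrable (fun y => ‖y‖ ^ n * ‖v y‖) := by
  obtain ⟨C₁, h1⟩ := hv 0
  obtain ⟨C₂, h2⟩ := hv (n + (volume : Measure (E p)).integrablePower)
  exact integrable_of_le_of_pow_mul_le (C₁ := C₁) (by simpa using h1) h2 hm

theorem RapidDecay.integrable {p : ℕ} {v : E p → ℂ} (hv : RapidDecay v)
    (hm : AEStronglyMeasurable v) : Integrable v := by
  have := hv.integrable_pow_mul hm 0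
  simp only [pow_zero, one_mul] at this
  exact (integrable_norm_iff hm).1 this

/-- A rapidly decaying function that is the Fourier transform of a rapidly decaying function is a
Schwartz function. -/
theorem exists_schwartz_of_fourier {p : ℕ} {u v : E p → ℂ} (hu : RapidDecay u)
    (hv : RapidDecay v) (hm : AEStronglyMeasurable v) (huv : u = 𝓕 v) :
    ∃ g : 𝓢(E p, ℂ), ⇑g = u := by
  have hint := fun n => hv.integrable_pow_mul hm n
  have hsm : ContDiff ℝ ∞ u := by
    rw [huv]
    exact Real.contDiff_fourier (N := ⊤) fun n _ => hint n
  have hbd : ∀ n, ∃ C, ∀ x, ‖iteratedFDeriv ℝ n u x‖ ≤ C := by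
    intro n
    refine ⟨∫ y, ‖VectorFourier.fourierPowSMulRight (innerSL ℝ) v y n‖, fun x => ?_⟩
    rw [huv, Real.iteratedFDeriv_fourier (N := ⊤) (fun n _ => hint n) hm (by exact_mod_cast le_top)]
    exact VectorFourier.norm_fourierIntegral_le_integral_norm _ _ _ _ _
  exact ⟨⟨u, hsm, fun N k => hu.iteratedFDeriv_of_bound k hsm hbd N⟩, rfl⟩

/-! ### Gaussians and polynomial multiples of Gaussians -/

theorem exp_mul_pow_bounded {b : ℝ} (hb : 0 < b) (N : ℕ) :
    ∃ C : ℝ, ∀ t : ℝ, 0 ≤ t → t ^ N * Real.exp (-b * t ^ 2) ≤ C := by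
  refine ⟨N.factorial / b ^ N + 1, fun t ht => ?_⟩
  rcases le_total t 1 with h1 | h1
  · have h2 : t ^ N ≤ 1 := pow_le_one₀ ht h1
    have h3 : Real.exp (-b * t ^ 2) ≤ 1 := Real.exp_le_one_iff.2 (by nlinarith [sq_nonneg t])
    have h4 : (0 : ℝ) ≤ N.factorial / b ^ N := by positivity
    nlinarith [mul_le_one₀ h2 (Real.exp_pos _).le h3]
  · have h2 : t ^ N ≤ (t ^ 2) ^ N := by
      rw [← pow_mul]; exact pow_le_pow_right₀ h1 (by omega)
    have h3 : (b * t ^ 2) ^ N / N.factorial ≤ Real.exp (b * t ^ 2) :=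
      Real.pow_div_factorial_le_exp _ (by positivity) N
    have h4 : t ^ N ≤ N.factorial / b ^ N * Real.exp (b * t ^ 2) := by
      rw [div_le_iff₀ (by positivity), mul_pow] at h3
      rw [div_mul_eq_mul_div, le_div_iff₀ (by positivity)]
      calc t ^ N * b ^ N ≤ (t ^ 2) ^ N * b ^ N := by gcongr
        _ ≤ _ := by linarith
    calc t ^ N * Real.exp (-b * t ^ 2)
        ≤ N.factorial / b ^ N * Real.exp (b * t ^ 2) * Real.exp (-b * t ^ 2) := by gcongr
      _ = N.factorial / b ^ N := by
          rw [mul_assoc, ← Real.exp_add]; simp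
      _ ≤ _ := by linarith

theorem norm_cexp_gaussian {V : Type*} [NormedAddCommGroup V] (b : ℝ) (x : V) :
    ‖Complex.exp (-b * ‖x‖ ^ 2)‖ = Real.exp (-b * ‖x‖ ^ 2) := by
  rw [Complex.norm_exp]
  congr 1
  norm_cast

theorem rapidDecay_gaussian (p : ℕ) {b : ℝ} (hb : 0 < b) :
    RapidDecay fun x : E p => Complex.exp (-b * ‖x‖ ^ 2) := fun N => by
  obtain ⟨C, hC⟩ := exp_mul_pow_bounded hb N
  exact ⟨C, fun x => by rw [norm_cexp_gaussian]; exact hC _ (norm_nonneg _)⟩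

/-- Gaussians are Schwartz functions: each is rapidly decaying and a multiple of the Fourier transform
of another Gaussian. -/
theorem exists_gaussian (p : ℕ) {b : ℝ} (hb : 0 < b) :
    ∃ g : 𝓢(E p, ℂ), ⇑g = fun x => Complex.exp (-b * ‖x‖ ^ 2) := by
  set a : ℝ := Real.pi ^ 2 / b with ha
  have ha0 : 0 < a := by positivity
  -- the Gaussian with parameter `b` is a multiple of the transform of the one with `π ^ 2 / b`
  have hF : ∀ w : E p, 𝓕 (fun v : E p => Complex.exp (-a * ‖v‖ ^ 2)) w =
      (Real.pi / a : ℂ) ^ (p / 2 : ℂ) * Complex.exp (-b * ‖w‖ ^ 2) := fun w => by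
    rw [fourier_gaussian_innerProductSpace (by simpa using ha0)]
    simp only [finrank_euclideanSpace, Fintype.card_fin]
    congr 2
    rw [ha]
    have : (b : ℂ) ≠ 0 := by exact_mod_cast hb.ne'
    have h2 : (Real.pi : ℂ) ≠ 0 := by exact_mod_cast Real.pi_ne_zero
    push_cast
    field_simp
  set c : ℂ := (Real.pi / a : ℂ) ^ (p / 2 : ℂ) with hc
  have hc0 : c ≠ 0 := by
    rw [hc, Complex.cpow_ne_zero_iff]
    left
    exact_mod_cast (div_pos Real.pi_pos ha0).ne'
  have hv := rapidDecay_gaussian p ha0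
  have hv' : RapidDecay fun v : E p => c⁻¹ * Complex.exp (-a * ‖v‖ ^ 2) := fun N => by
    obtain ⟨C, hC⟩ := hv N
    refine ⟨‖c⁻¹‖ * C, fun x => ?_⟩
    rw [norm_mul, mul_left_comm]
    gcongr
    exact hC x
  refine exists_schwartz_of_fourier (rapidDecay_gaussian p hb) hv' ?_ ?_
  · exact Continuous.aestronglyMeasurable (by fun_prop)
  · ext w
    have h1 : 𝓕 (fun v : E p => c⁻¹ * Complex.exp (-a * ‖v‖ ^ 2)) w =
        c⁻¹ * 𝓕 (fun v : E p => Complex.exp (-a * ‖v‖ ^ 2)) w := by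
      simp only [Real.fourier_eq', smul_eq_mul]
      rw [← integral_const_mul]
      congr 1; ext v; ring
    rw [h1, hF w, ← mul_assoc, inv_mul_cancel₀ hc0, one_mul]

/-- The Gaussian `exp (-b ‖x‖ ^ 2)` on `ℝ^p` as a Schwartz function, for `b > 0`
(and `0` for `b ≤ 0`). -/
def gaussian (p : ℕ) (b : ℝ) : 𝓢(E p, ℂ) :=
  if hb : 0 < b then (exists_gaussian p hb).choose else 0

theorem gaussian_apply {p : ℕ} {b : ℝ} (hb : 0 < b) (x : E p) :
    gaussian p b x = Complex.exp (-b * ‖x‖ ^ 2) := by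
  rw [gaussian, dif_pos hb, (exists_gaussian p hb).choose_spec]

theorem evalAt_X {d : ℕ} (x : E d) (i : Fin d) :
    evalAt x (MvPolynomial.X i : MvPolynomial (Fin d) ℂ) = x i := by simp [evalAt_apply]

theorem evalAt_C {d : ℕ} (x : E d) (a : ℂ) :
    evalAt x (MvPolynomial.C a : MvPolynomial (Fin d) ℂ) = a := by simp [evalAt_apply]

theorem evalAt_mul {d : ℕ} (x : E d) (P Q : MvPolynomial (Fin d) ℂ) :
    evalAt x (P * Q) = evalAt x P * evalAt x Q := by simp [evalAt_apply]

theorem hasTemperateGrowth_coord {d : ℕ} (i : Fin d) :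
    (fun x : E d => (x i : ℂ)).HasTemperateGrowth :=
  (Complex.ofRealCLM.comp (EuclideanSpace.proj i : E d →L[ℝ] ℝ)).hasTemperateGrowth

theorem hasTemperateGrowth_evalAt {d : ℕ} (P : MvPolynomial (Fin d) ℂ) :
    (fun x : E d => evalAt x P).HasTemperateGrowth := by
  induction P using MvPolynomial.induction_on with
  | C a => simpa only [evalAt_C] using Function.HasTemperateGrowth.const a
  | add P Q hP hQ =>
    simp only [map_add]
    exact hP.add hQ
  | mul_X P i hP =>
    simp only [evalAt_mul, evalAt_X]
    exact hP.mul (hasTemperateGrowth_coord i)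

/-- The `i`-th vector of the standard basis of `ℝ^d`. -/
def stdVec {d : ℕ} (i : Fin d) : E d := EuclideanSpace.single i 1

theorem hasFDerivAt_coord {d : ℕ} (i : Fin d) (x : E d) :
    HasFDerivAt (fun x : E d => (x i : ℂ))
      (Complex.ofRealCLM.comp (EuclideanSpace.proj i : E d →L[ℝ] ℝ)) x :=
  (Complex.ofRealCLM.comp (EuclideanSpace.proj i : E d →L[ℝ] ℝ)).hasFDerivAt

theorem differentiable_evalAt {d : ℕ} (P : MvPolynomial (Fin d) ℂ) :
    Differentiable ℝ fun x : E d => evalAt x P :=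
  (hasTemperateGrowth_evalAt P).1.differentiable (by simp)

theorem fderiv_evalAt {d : ℕ} (P : MvPolynomial (Fin d) ℂ) (x : E d) (i : Fin d) :
    fderiv ℝ (fun x : E d => evalAt x P) x (stdVec i) = evalAt x (MvPolynomial.pderiv i P) := by
  induction P using MvPolynomial.induction_on with
  | C a => simp [evalAt_C]
  | add P Q hP hQ =>
    simp only [map_add]
    rw [fderiv_fun_add (differentiable_evalAt P x) (differentiable_evalAt Q x),
      add_apply, hP, hQ]
  | mul_X P j hP =>
    simp only [evalAt_mul, evalAt_X]
    have hj := hasFDerivAt_coord j x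
    rw [fderiv_fun_mul (differentiable_evalAt P x) hj.differentiableAt, hj.fderiv]
    simp only [add_apply, smul_apply, hP, Derivation.leibniz,
      MvPolynomial.pderiv_X, map_add, smul_eq_mul, evalAt_mul, evalAt_X]
    by_cases h : j = i
    · subst h
      simp [stdVec, evalAt_apply]
    · simp [stdVec, h, evalAt_apply]

/-- Multiplication of a Schwartz function by a polynomial. -/
def polyMul {d : ℕ} (P : MvPolynomial (Fin d) ℂ) (f : 𝓢(E d, ℂ)) : 𝓢(E d, ℂ) :=
  smulLeftCLM ℂ (fun x : E d => evalAt x P) f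

@[simp]
theorem polyMul_apply {d : ℕ} (P : MvPolynomial (Fin d) ℂ) (f : 𝓢(E d, ℂ)) (x : E d) :
    polyMul P f x = evalAt x P * f x := by
  simp [polyMul, smulLeftCLM_apply_apply (hasTemperateGrowth_evalAt P)]

theorem lineDeriv_polyMul {d : ℕ} (P : MvPolynomial (Fin d) ℂ) (f : 𝓢(E d, ℂ)) (i : Fin d) :
    ∂_{stdVec i} (polyMul P f) =
      polyMul (MvPolynomial.pderiv i P) f + polyMul P (∂_{stdVec i} f) := by
  ext x
  have h : ⇑(polyMul P f) = fun x => evalAt x P * f x := funext (polyMul_apply P f)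
  simp only [lineDerivOp_apply_eq_fderiv, add_apply, polyMul_apply]
  rw [h, fderiv_fun_mul (differentiable_evalAt P x) f.differentiableAt]
  simp [fderiv_evalAt]
  ring

theorem lineDeriv_gaussian {d : ℕ} {b : ℝ} (hb : 0 < b) (i : Fin d) :
    ∂_{stdVec i} (gaussian d b) = (-2 * b : ℂ) • polyMul (MvPolynomial.X i) (gaussian d b) := by
  ext x
  have h : ⇑(gaussian d b) = fun x => Complex.exp (-b * ‖x‖ ^ 2) := funext (gaussian_apply hb)
  simp only [lineDerivOp_apply_eq_fderiv, smul_apply, polyMul_apply, evalAt_X, h]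
  have h1 : HasFDerivAt (fun x : E d => (‖x‖ ^ 2 : ℝ)) (2 • innerSL ℝ x) x :=
    (hasStrictFDerivAt_norm_sq x).hasFDerivAt
  have h2 := ((Complex.ofRealCLM.hasFDerivAt.comp x h1).const_mul (-b : ℂ)).cexp
  have h3 : (fun x : E d => Complex.exp (-b * ‖x‖ ^ 2)) =
      fun x => Complex.exp (-b * (Complex.ofRealCLM ∘ fun x : E d => (‖x‖ ^ 2 : ℝ)) x) := by
    ext x; simp
  rw [h3, h2.fderiv]
  simp [stdVec, EuclideanSpace.inner_single_right]
  ring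

theorem lineDeriv_gaussian_apply {d : ℕ} {b : ℝ} (hb : 0 < b) (i : Fin d) (x : E d) :
    (∂_{stdVec i} (gaussian d b)) x = -2 * b * x i * gaussian d b x := by
  rw [lineDeriv_gaussian hb]
  simp [evalAt_X]
  ring

theorem inner_stdVec {d : ℕ} (i : Fin d) (x : E d) : inner ℝ x (stdVec i) = x i := by
  simp [stdVec, EuclideanSpace.inner_single_right]

theorem fourier_polyMul_X {d : ℕ} (f : 𝓢(E d, ℂ)) (i : Fin d) :
    𝓕 (polyMul (MvPolynomial.X i) f) = (Complex.I / (2 * Real.pi)) • ∂_{stdVec i} (𝓕 f) := by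
  have hπ : (Real.pi : ℂ) ≠ 0 := by exact_mod_cast Real.pi_ne_zero
  have h1 : smulLeftCLM ℂ (fun x : E d => inner ℝ x (stdVec i)) f =
      polyMul (MvPolynomial.X i) f := by
    ext x
    rw [smulLeftCLM_apply_apply (by fun_prop)]
    simp [inner_stdVec, evalAt_X]
  rw [lineDerivOp_fourier_eq, h1, FourierTransform.fourier_smul, smul_smul]
  have : Complex.I / (2 * Real.pi) * -(2 * Real.pi * Complex.I) = 1 := by
    field_simp
    simp
  rw [this, one_smul]

theorem fourier_lineDeriv {d : ℕ} (f : 𝓢(E d, ℂ)) (i : Fin d) :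
    𝓕 (∂_{stdVec i} f) = (2 * Real.pi * Complex.I) • polyMul (MvPolynomial.X i) (𝓕 f) := by
  rw [fourier_lineDerivOp_eq]
  congr 1
  ext x
  rw [smulLeftCLM_apply_apply (by fun_prop)]
  simp [inner_stdVec, evalAt_X]

theorem fourier_gaussian {d : ℕ} {b : ℝ} (hb : 0 < b) :
    𝓕 (gaussian d b) = ((Real.pi / b : ℂ) ^ (d / 2 : ℂ)) • gaussian d (Real.pi ^ 2 / b) := by
  ext w
  have h : ⇑(gaussian d b) = fun x => Complex.exp (-b * ‖x‖ ^ 2) := funext (gaussian_apply hb)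
  rw [fourier_coe, h, fourier_gaussian_innerProductSpace (by simpa using hb), smul_apply,
    gaussian_apply (by positivity)]
  simp only [finrank_euclideanSpace, Fintype.card_fin, smul_eq_mul]
  congr 2
  push_cast
  ring

/-! ### Polar coordinates and determination by Gaussian integrals -/

/-- The surface area of `S^{d-1}`. -/
def sphereArea (d : ℕ) : ℝ := (volume : Measure (E d)).toSphere.real Set.univ

theorem sphereArea_pos {d : ℕ} (hd : 2 ≤ d) : 0 < sphereArea d := by
  have : Nonempty (Fin d) := ⟨⟨0, by omega⟩⟩
  exact ENNReal.toReal_pos (Measure.measure_univ_ne_zero.2 (Measure.toSphere_ne_zero _))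
    (measure_ne_top _ _)

theorem integral_toSphere {d : ℕ} (hd : 2 ≤ d) (F : S d → ℂ) :
    ∫ ζ, F ζ ∂(volume : Measure (E d)).toSphere = sphereArea d * ∫ ζ, F ζ ∂sphereMeasure d := by
  have h := sphereArea_pos hd
  rw [sphereMeasure, integral_smul_measure, ENNReal.toReal_inv, Complex.real_smul, ← mul_assoc]
  change _ = _ * (((sphereArea d)⁻¹ : ℝ) : ℂ) * _
  rw [← Complex.ofReal_mul, mul_inv_cancel₀ h.ne']
  simp

/-- Integration in polar coordinates. -/
theorem integral_polar {d : ℕ} (hd : 2 ≤ d) {F : E d → ℂ} (hF : Integrable F) :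
    ∫ x, F x = sphereArea d *
      ∫ r in Set.Ioi (0 : ℝ), (r : ℂ) ^ (d - 1) * ∫ ζ : S d, F (r • (ζ : E d)) ∂sphereMeasure d := by
  have : Nonempty (Fin d) := ⟨⟨0, by omega⟩⟩
  set μ : Measure (E d) := volume with hμ
  have hmp := μ.measurePreserving_homeomorphUnitSphereProd
  have hemb := (Homeomorph.measurableEmbedding (homeomorphUnitSphereProd (E d)))
  set G : S d × Set.Ioi (0 : ℝ) → ℂ := fun z => F ((z.2 : ℝ) • (z.1 : E d)) with hG
  have hGF : ∀ x : ({0}ᶜ : Set (E d)), G (homeomorphUnitSphereProd (E d) x) = F x := fun x => by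
    have h0 : ‖(x : E d)‖ ≠ 0 := norm_ne_zero_iff.2 x.2
    simp [hG, smul_smul, h0]
  have h1 : ∫ x, F x ∂μ = ∫ x : ({0}ᶜ : Set (E d)), F x ∂(μ.comap (↑)) := by
    rw [integral_subtype_comap (measurableSet_singleton _).compl fun x => F x,
      restrict_compl_singleton]
  have h2 : ∫ x : ({0}ᶜ : Set (E d)), F x ∂(μ.comap (↑)) =
      ∫ z, G z ∂(μ.toSphere.prod (Measure.volumeIoiPow (Module.finrank ℝ (E d) - 1))) := by
    rw [← hmp.integral_comp hemb]
    simp only [hGF]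
  have h3 : Integrable G (μ.toSphere.prod (Measure.volumeIoiPow (Module.finrank ℝ (E d) - 1))) := by
    rw [← hmp.integrable_comp_emb hemb]
    have : G ∘ homeomorphUnitSphereProd (E d) = F ∘ Subtype.val := funext hGF
    rw [this]
    exact (MeasurableEmbedding.subtype_coe (measurableSet_singleton (0 : E d)).compl).integrable_map_iff.1
      (by rw [map_comap_subtype_coe (measurableSet_singleton _).compl]; exact hF.restrict)
  rw [h1, h2, integral_prod_symm _ h3]
  simp only [hG]
  have h4 : ∀ r : Set.Ioi (0 : ℝ), ∫ ζ : S d, F ((r : ℝ) • (ζ : E d)) ∂μ.toSphere =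
      sphereArea d * ∫ ζ : S d, F ((r : ℝ) • (ζ : E d)) ∂sphereMeasure d := fun r =>
    integral_toSphere hd _
  simp only [h4]
  rw [integral_const_mul]
  congr 1
  simp only [Measure.volumeIoiPow, ENNReal.ofReal]
  rw [integral_withDensity_eq_integral_smul
    ((measurable_subtype_coe.pow_const _).real_toNNReal),
    integral_subtype_comap measurableSet_Ioi fun a : ℝ =>
      Real.toNNReal (a ^ (Module.finrank ℝ (E d) - 1)) •
        ∫ ζ : S d, F (a • (ζ : E d)) ∂sphereMeasure d]
  refine setIntegral_congr_fun measurableSet_Ioi fun r hr => ?_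
  simp only [NNReal.smul_def, Real.coe_toNNReal _ (pow_nonneg (Set.mem_Ioi.1 hr).le _),
    finrank_euclideanSpace, Fintype.card_fin, Complex.real_smul, Complex.ofReal_pow]

theorem integral_sphere_const {d : ℕ} (hd : 2 ≤ d) (a : ℂ) :
    ∫ _ζ : S d, a ∂sphereMeasure d = a := by
  rw [integral_const, measureReal_def, sphereMeasure_univ hd]
  simp

/-- A bounded continuous function on the half line whose integrals against `r ^ n e^{-b r²}`, `b > 0`,
all vanish is zero: by the Weierstrass theorem in the variable `u = e^{-r²} ∈ [0, 1]` it is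
orthogonal to itself with respect to a positive weight. -/
theorem eq_zero_of_gaussian_moments_real {n : ℕ} (hn : 1 ≤ n) {M : ℝ → ℝ} (hM : Continuous M)
    {C : ℝ} (hC : ∀ r, |M r| ≤ C)
    (h : ∀ b : ℝ, 0 < b → ∫ r in Set.Ioi (0 : ℝ), r ^ n * (M r * Real.exp (-b * r ^ 2)) = 0) :
    ∀ r, 0 < r → M r = 0 := by
  set g : ℝ → ℝ := fun r => r ^ n * (M r * Real.exp (-1 * r ^ 2)) with hg
  have hgc : Continuous g := by fun_prop
  have hg0 : g 0 = 0 := by simp [hg]; exact Or.inl (by omega)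
  have hC0 : 0 ≤ C := (abs_nonneg _).trans (hC 0)
  have hgle : ∀ r, 0 ≤ r → ‖g r‖ ≤ C * (r ^ n * Real.exp (-1 * r ^ 2)) := fun r hr => by
    simp only [hg, norm_mul, Real.norm_eq_abs, abs_pow, abs_of_nonneg hr, Real.abs_exp]
    have := mul_le_mul_of_nonneg_left (hC r)
      (mul_nonneg (pow_nonneg hr n) (Real.exp_pos (-1 * r ^ 2)).le)
    linarith
  have hwi : IntegrableOn (fun r : ℝ => r ^ n * Real.exp (-1 * r ^ 2)) (Set.Ioi 0) := by
    have := integrableOn_rpow_mul_exp_neg_mul_sq (b := 1) one_pos (s := n)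
      (by have : (0 : ℝ) ≤ n := n.cast_nonneg
          linarith)
    refine this.congr_fun (fun r hr => ?_) measurableSet_Ioi
    simp [Real.rpow_natCast]
  have hgi : IntegrableOn g (Set.Ioi 0) := by
    refine (hwi.const_mul C).mono' hgc.aestronglyMeasurable.restrict ?_
    exact (ae_restrict_mem measurableSet_Ioi).mono fun r hr => hgle r (Set.mem_Ioi.1 hr).le
  have hglim : Tendsto g atTop (𝓝 0) := by
    obtain ⟨D, hD⟩ := exp_mul_pow_bounded (b := 1) one_pos (n + 1)
    refine squeeze_zero_norm' (a := fun r => C * D * r⁻¹) ?_ ?_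
    · filter_upwards [eventually_gt_atTop 0] with r hr
      refine (hgle r hr.le).trans ?_
      rw [mul_assoc]
      refine mul_le_mul_of_nonneg_left ?_ hC0
      rw [← div_eq_mul_inv, le_div_iff₀ hr]
      calc _ = r ^ (n + 1) * Real.exp (-1 * r ^ 2) := by ring
        _ ≤ D := hD r hr.le
    · simpa using tendsto_inv_atTop_zero.const_mul (C * D)
  -- the profile of `g` in the variable `u`, with value `0` at `u = 0` (where `Real.log 0 = 0`)
  set ψ : ℝ → ℝ := fun u => g (Real.sqrt (-Real.log u)) with hψ
  have hψc : ContinuousOn ψ (Set.Icc 0 1) := by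
    intro u hu
    rcases eq_or_lt_of_le hu.1 with h0 | h0
    · subst h0
      have hψ0 : ψ 0 = 0 := by simp [hψ, hg0]
      rw [ContinuousWithinAt, hψ0]
      have h1 : Tendsto ψ (𝓝[>] 0) (𝓝 0) := by
        refine hglim.comp (Real.tendsto_sqrt_atTop.comp ?_)
        exact tendsto_neg_atBot_atTop.comp Real.tendsto_log_nhdsGT_zero
      have h2 : Tendsto ψ (𝓝[≥] 0) (𝓝 0) := by
        rw [← Set.Ioi_insert, nhdsWithin_insert, tendsto_sup]
        refine ⟨?_, h1⟩
        have := tendsto_pure_nhds ψ 0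
        rwa [hψ0] at this
      exact h2.mono_left (nhdsWithin_mono _ Set.Icc_subset_Ici_self)
    · refine ContinuousAt.continuousWithinAt ?_
      exact hgc.continuousAt.comp (Real.continuous_sqrt.continuousAt.comp
        (Real.continuousAt_log h0.ne').neg)
  have hψg : ∀ r, 0 < r → ψ (Real.exp (-1 * r ^ 2)) = g r := fun r hr => by
    simp [hψ, Real.sqrt_sq hr.le]
  have hu01 : ∀ r : ℝ, Real.exp (-1 * r ^ 2) ∈ Set.Icc (0 : ℝ) 1 := fun r =>
    ⟨(Real.exp_pos _).le, Real.exp_le_one_iff.2 (by nlinarith [sq_nonneg r])⟩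
  have hpoly : ∀ q : Polynomial ℝ,
      ∫ r in Set.Ioi (0 : ℝ), q.eval (Real.exp (-1 * r ^ 2)) * g r = 0 := by
    intro q
    have h1 : ∀ r : ℝ, q.eval (Real.exp (-1 * r ^ 2)) * g r =
        ∑ k ∈ Finset.range (q.natDegree + 1),
          q.coeff k * (r ^ n * (M r * Real.exp (-(k + 1 : ℝ) * r ^ 2))) := fun r => by
      rw [Polynomial.eval_eq_sum_range, Finset.sum_mul]
      refine Finset.sum_congr rfl fun k _ => ?_
      have : Real.exp (-(k + 1 : ℝ) * r ^ 2) =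
          Real.exp (-1 * r ^ 2) ^ k * Real.exp (-1 * r ^ 2) := by
        rw [← Real.exp_nat_mul, ← Real.exp_add]; congr 1; ring
      rw [this]; simp only [hg]; ring
    simp only [h1]
    rw [integral_finsetSum]
    · refine Finset.sum_eq_zero fun k _ => ?_
      rw [integral_const_mul, h _ (by positivity), mul_zero]
    · intro k _
      refine Integrable.const_mul ?_ _
      refine (hwi.const_mul C).mono' (Continuous.aestronglyMeasurable (by fun_prop)) ?_
      refine (ae_restrict_mem measurableSet_Ioi).mono fun r hr => ?_
      have hr' := (Set.mem_Ioi.1 hr).le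
      have h2 : Real.exp (-(k + 1 : ℝ) * r ^ 2) ≤ Real.exp (-1 * r ^ 2) := by
        rw [Real.exp_le_exp]
        have : (0 : ℝ) ≤ k := k.cast_nonneg
        nlinarith [sq_nonneg r]
      simp only [norm_mul, Real.norm_eq_abs, abs_pow, abs_of_nonneg hr', Real.abs_exp]
      calc r ^ n * (|M r| * Real.exp (-(k + 1 : ℝ) * r ^ 2))
          ≤ r ^ n * (C * Real.exp (-1 * r ^ 2)) := by gcongr; exact hC r
        _ = _ := by ring
  have hcont : ∀ q : Polynomial ℝ, Continuous fun r : ℝ => q.eval (Real.exp (-1 * r ^ 2)) :=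
    fun q => q.continuous.comp (by fun_prop)
  have hgsq : IntegrableOn (fun r => g r * g r) (Set.Ioi 0) := by
    obtain ⟨D, hD⟩ := exp_mul_pow_bounded (b := 1) one_pos n
    refine (hgi.norm.const_mul (C * D)).mono' (hgc.mul hgc).aestronglyMeasurable ?_
    refine (ae_restrict_mem measurableSet_Ioi).mono fun r hr => ?_
    rw [norm_mul]
    gcongr
    refine (hgle r (Set.mem_Ioi.1 hr).le).trans ?_
    gcongr
    exact hD r (Set.mem_Ioi.1 hr).le
  have hzero : ∫ r in Set.Ioi (0 : ℝ), g r * g r = 0 := by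
    set A := ∫ r in Set.Ioi (0 : ℝ), ‖g r‖ with hA
    have hA0 : 0 ≤ A := integral_nonneg fun r => norm_nonneg _
    have hle : ∀ ε > 0, ‖∫ r in Set.Ioi (0 : ℝ), g r * g r‖ ≤ ε * A := by
      intro ε hε
      obtain ⟨q, hq⟩ := exists_polynomial_near_of_continuousOn 0 1 ψ hψc ε hε
      have hqi : IntegrableOn (fun r => q.eval (Real.exp (-1 * r ^ 2)) * g r) (Set.Ioi 0) := by
        obtain ⟨B, hB⟩ := (isCompact_Icc (a := (0 : ℝ)) (b := 1)).exists_bound_of_continuousOn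
          q.continuous.continuousOn
        refine (hgi.norm.const_mul B).mono' ((hcont q).mul hgc).aestronglyMeasurable ?_
        refine ae_of_all _ fun r => ?_
        rw [norm_mul]
        gcongr
        exact hB _ (hu01 r)
      have h1 : ∫ r in Set.Ioi (0 : ℝ), g r * g r =
          ∫ r in Set.Ioi (0 : ℝ), (g r * g r - q.eval (Real.exp (-1 * r ^ 2)) * g r) := by
        rw [integral_sub hgsq hqi, hpoly q, sub_zero]
      rw [h1, hA, ← integral_const_mul]
      refine norm_integral_le_of_norm_le (hgi.norm.const_mul ε) ?_
      refine (ae_restrict_mem measurableSet_Ioi).mono fun r hr => ?_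
      rw [← sub_mul, norm_mul]
      gcongr
      have h2 := hq _ (hu01 r)
      rw [hψg r hr, abs_sub_comm] at h2
      exact h2.le
    have : ‖∫ r in Set.Ioi (0 : ℝ), g r * g r‖ ≤ 0 := by
      refine le_of_forall_pos_le_add fun ε hε => ?_
      refine (hle (ε / (A + 1)) (by positivity)).trans ?_
      rw [zero_add, div_mul_eq_mul_div, div_le_iff₀ (by positivity)]
      nlinarith
    exact norm_le_zero_iff.1 this
  intro r hr
  rw [integral_eq_zero_iff_of_nonneg (fun r => mul_self_nonneg _) hgsq] at hzero
  have h3 := Measure.eqOn_open_of_ae_eq hzero isOpen_Ioi (hgc.mul hgc).continuousOn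
    continuousOn_const (Set.mem_Ioi.2 hr)
  have h4 : g r = 0 := by simpa using h3
  simpa [hg, hr.ne', (Real.exp_pos _).ne'] using h4

/-- Complex version of `eq_zero_of_gaussian_moments_real`. -/
theorem eq_zero_of_gaussian_moments {n : ℕ} (hn : 1 ≤ n) {M : ℝ → ℂ} (hM : Continuous M)
    {C : ℝ} (hC : ∀ r, ‖M r‖ ≤ C)
    (h : ∀ b : ℝ, 0 < b →
      ∫ r in Set.Ioi (0 : ℝ), (r : ℂ) ^ n * (M r * Complex.exp (-b * r ^ 2)) = 0) :
    ∀ r, 0 < r → M r = 0 := by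
  have hint : ∀ b : ℝ, 0 < b → IntegrableOn
      (fun r : ℝ => (r : ℂ) ^ n * (M r * Complex.exp (-b * r ^ 2))) (Set.Ioi 0) := by
    intro b hb
    have hw : IntegrableOn (fun r : ℝ => r ^ n * Real.exp (-b * r ^ 2)) (Set.Ioi 0) := by
      have := integrableOn_rpow_mul_exp_neg_mul_sq (b := b) hb (s := n)
        (by have : (0 : ℝ) ≤ n := n.cast_nonneg
            linarith)
      refine this.congr_fun (fun r hr => ?_) measurableSet_Ioi
      simp [Real.rpow_natCast]
    refine (hw.const_mul C).mono' (Continuous.aestronglyMeasurable (by fun_prop)) ?_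
    refine (ae_restrict_mem measurableSet_Ioi).mono fun r hr => ?_
    have h1 := norm_cexp_gaussian b r
    rw [Real.norm_of_nonneg (Set.mem_Ioi.1 hr).le] at h1
    rw [norm_mul, norm_mul, norm_pow, Complex.norm_real,
      Real.norm_of_nonneg (Set.mem_Ioi.1 hr).le, h1]
    calc r ^ n * (‖M r‖ * Real.exp (-b * r ^ 2)) ≤ r ^ n * (C * Real.exp (-b * r ^ 2)) := by
          gcongr
          · exact pow_nonneg (Set.mem_Ioi.1 hr).le _
          · exact hC r
      _ = _ := by ring
  have hform : ∀ (b r : ℝ), (r : ℂ) ^ n * (M r * Complex.exp (-b * r ^ 2)) =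
      ((r ^ n * Real.exp (-b * r ^ 2) : ℝ) : ℂ) * M r := fun b r => by
    push_cast; ring
  have hre : ∀ r, 0 < r → (M r).re = 0 := by
    refine eq_zero_of_gaussian_moments_real hn (Complex.continuous_re.comp hM) (C := C)
      (fun r => (Complex.abs_re_le_norm _).trans (hC r)) fun b hb => ?_
    have h1 := congrArg Complex.re (h b hb)
    have h2 := integral_re (𝕜 := ℂ) (hint b hb)
    simp only [RCLike.re_to_complex] at h2
    rw [← h2, Complex.zero_re] at h1
    refine Eq.trans ?_ h1
    refine integral_congr_ae (ae_of_all _ fun r => ?_)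
    simp only [hform, Complex.re_ofReal_mul]
    ring
  have him : ∀ r, 0 < r → (M r).im = 0 := by
    refine eq_zero_of_gaussian_moments_real hn (Complex.continuous_im.comp hM) (C := C)
      (fun r => (Complex.abs_im_le_norm _).trans (hC r)) fun b hb => ?_
    have h1 := congrArg Complex.im (h b hb)
    have h2 := integral_im (𝕜 := ℂ) (hint b hb)
    simp only [RCLike.im_to_complex] at h2
    rw [← h2, Complex.zero_im] at h1
    refine Eq.trans ?_ h1
    refine integral_congr_ae (ae_of_all _ fun r => ?_)
    simp only [hform, Complex.im_ofReal_mul]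
    ring
  exact fun r hr => Complex.ext (hre r hr) (him r hr)

theorem norm_sphere_integral_le {d : ℕ} (hd : 2 ≤ d) {F : S d → ℂ} {C : ℝ} (h : ∀ ζ, ‖F ζ‖ ≤ C) :
    ‖∫ ζ, F ζ ∂sphereMeasure d‖ ≤ C := by
  have := norm_integral_le_of_norm_le_const (μ := sphereMeasure d) (ae_of_all _ h)
  simpa [measureReal_def, sphereMeasure_univ hd] using this

theorem continuous_sphere_integral {d : ℕ} {X : Type*} [TopologicalSpace X]
    [FirstCountableTopology X] [LocallyCompactSpace X]
    {F : X → S d → ℂ} (hF : Continuous (Function.uncurry F)) :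
    Continuous fun a => ∫ ζ, F a ζ ∂sphereMeasure d := by
  have := continuousOn_integral_of_compact_support (μ := sphereMeasure d) (s := Set.univ)
    (k := Set.univ) (f := F) isCompact_univ hF.continuousOn (by simp)
  rwa [continuousOn_univ] at this

/-- The spherical means of a bounded continuous function vanish as soon as its integrals against
all Gaussians do. -/
theorem sphere_integral_eq_zero {d : ℕ} (hd : 2 ≤ d) {F : E d → ℂ} (hF : Continuous F) {C : ℝ}
    (hC : ∀ x, ‖F x‖ ≤ C) (h : ∀ b : ℝ, 0 < b → ∫ x, F x * gaussian d b x = 0) {r : ℝ}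
    (hr : 0 < r) : ∫ ζ : S d, F (r • (ζ : E d)) ∂sphereMeasure d = 0 := by
  refine eq_zero_of_gaussian_moments (n := d - 1) (by omega)
    (M := fun r => ∫ ζ : S d, F (r • (ζ : E d)) ∂sphereMeasure d)
    (continuous_sphere_integral (hF.comp (by fun_prop))) (C := C)
    (fun r => norm_sphere_integral_le hd fun ζ => hC _) (fun b hb => ?_) r hr
  have h1 : Integrable fun x => F x * gaussian d b x :=
    (gaussian d b).integrable.bdd_mul hF.aestronglyMeasurable (ae_of_all _ hC)
  have h2 := h b hb
  rw [integral_polar hd h1, mul_eq_zero, or_iff_right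
    (by exact_mod_cast (sphereArea_pos hd).ne')] at h2
  rw [← h2]
  refine setIntegral_congr_fun measurableSet_Ioi fun r hr => ?_
  have h3 : ∀ ζ : S d, ‖r • (ζ : E d)‖ = r := fun ζ => by
    rw [norm_smul, norm_eq_of_mem_sphere, mul_one, Real.norm_of_nonneg (Set.mem_Ioi.1 hr).le]
  simp only [gaussian_apply hb, h3, integral_mul_const]

open MvPolynomial (X C pderiv IsHomogeneous)

/-! ### Orthogonality and completeness of spherical harmonics -/

/-- The polynomial with complex conjugate coefficients. -/
def conjPoly {d : ℕ} (P : MvPolynomial (Fin d) ℂ) : MvPolynomial (Fin d) ℂ :=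
  MvPolynomial.map (starRingEnd ℂ) P

@[simp]
theorem evalAt_conjPoly {d : ℕ} (x : E d) (P : MvPolynomial (Fin d) ℂ) :
    evalAt x (conjPoly P) = starRingEnd ℂ (evalAt x P) := by
  induction P using MvPolynomial.induction_on with
  | C a => simp [conjPoly, evalAt_apply]
  | add P Q hP hQ =>
    simp only [conjPoly] at hP hQ ⊢
    simp [hP, hQ]
  | mul_X P i hP =>
    simp only [conjPoly] at hP ⊢
    simp [hP, evalAt_mul, evalAt_X]

theorem conjPoly_mem {d m : ℕ} {q : MvPolynomial (Fin d) ℂ} (hq : q ∈ harmonicPoly d m) :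
    conjPoly q ∈ harmonicPoly d m := by
  rw [mem_harmonicPoly] at hq ⊢
  refine ⟨hq.1.map _, ?_⟩
  simp only [conjPoly, MvPolynomial.pderiv_map]
  rw [← map_sum, hq.2, map_zero]

/-- The integral of a polynomial against the standard Gaussian. -/
def gaussInt {d : ℕ} (P : MvPolynomial (Fin d) ℂ) : ℂ := ∫ x, polyMul P (gaussian d (1 / 2)) x

theorem gaussInt_add {d : ℕ} (P Q : MvPolynomial (Fin d) ℂ) :
    gaussInt (P + Q) = gaussInt P + gaussInt Q := by
  rw [gaussInt, gaussInt, gaussInt, ← integral_add (polyMul P _).integrable (polyMul Q _).integrable]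
  simp [add_mul]

theorem gaussInt_smul {d : ℕ} (a : ℂ) (P : MvPolynomial (Fin d) ℂ) :
    gaussInt (a • P) = a * gaussInt P := by
  rw [gaussInt, gaussInt, ← integral_const_mul]
  simp [mul_assoc]

/-- `gaussInt` as a linear form. -/
def gaussForm (d : ℕ) : MvPolynomial (Fin d) ℂ →ₗ[ℂ] ℂ where
  toFun := gaussInt
  map_add' := gaussInt_add
  map_smul' := gaussInt_smul

theorem gaussForm_apply {d : ℕ} (P : MvPolynomial (Fin d) ℂ) :
    gaussForm d P = ∫ x, evalAt x P * gaussian d (1 / 2) x := by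
  simp [gaussForm, gaussInt]

/-- Integration by parts against the weight `e^{-|x|²/2}`. -/
theorem gaussForm_pderiv {d : ℕ} (P : MvPolynomial (Fin d) ℂ) (i : Fin d) :
    gaussForm d (pderiv i P) = gaussForm d (X i * P) := by
  have h := integral_mul_lineDerivOp_right_eq_neg_left (μ := volume)
    (polyMul P (gaussian d (1 / 4))) (gaussian d (1 / 4)) (stdVec i)
  have hg : ∀ x : E d, gaussian d (1 / 4) x * gaussian d (1 / 4) x = gaussian d (1 / 2) x :=
    fun x => by
      rw [gaussian_apply (by norm_num), gaussian_apply (by norm_num), ← Complex.exp_add]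
      congr 1; push_cast; ring
  have h1 : ∫ x, polyMul P (gaussian d (1 / 4)) x * (∂_{stdVec i} (gaussian d (1 / 4))) x =
      -(1 / 2) * gaussForm d (X i * P) := by
    rw [gaussForm_apply, ← integral_const_mul]
    congr 1; ext x
    rw [lineDeriv_gaussian_apply (by norm_num), polyMul_apply, evalAt_mul, evalAt_X, ← hg]
    push_cast; ring
  have h2 : ∫ x, (∂_{stdVec i} (polyMul P (gaussian d (1 / 4)))) x * gaussian d (1 / 4) x =
      gaussForm d (pderiv i P - (1 / 2 : ℂ) • (X i * P)) := by
    rw [gaussForm_apply]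
    congr 1; ext x
    rw [lineDeriv_polyMul, add_apply, polyMul_apply, polyMul_apply,
      lineDeriv_gaussian_apply (by norm_num), map_sub, map_smul, evalAt_mul, evalAt_X, ← hg,
      smul_eq_mul]
    push_cast; ring
  rw [h1, h2, map_sub, map_smul, smul_eq_mul] at h
  linear_combination h

/-- The ratio between the Gaussian integral and the spherical mean of a homogeneous polynomial of
degree `n`. -/
theorem gaussForm_eq_sphere {d : ℕ} (hd : 2 ≤ d) (n : ℕ) :
    ∃ γ : ℂ, γ ≠ 0 ∧ ∀ P : MvPolynomial (Fin d) ℂ, P.IsHomogeneous n →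
      gaussForm d P = γ * ∫ ζ : S d, evalAt (ζ : E d) P ∂sphereMeasure d := by
  set A : ℝ := ∫ r in Set.Ioi (0 : ℝ), r ^ (d - 1 + n) * Real.exp (-(1 / 2) * r ^ 2) with hA
  have hA0 : A ≠ 0 := by
    have h0 : (0 : ℝ) ≤ (d - 1 + n : ℕ) := Nat.cast_nonneg _
    have := integral_rpow_mul_exp_neg_mul_rpow (p := 2) (q := (d - 1 + n : ℕ)) (b := 1 / 2)
      (by norm_num) (by linarith) (by norm_num)
    simp only [Real.rpow_natCast, Real.rpow_two] at this
    rw [hA, this]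
    have h1 := Real.Gamma_pos_of_pos (s := ((d - 1 + n : ℕ) + 1 : ℝ) / 2) (by positivity)
    positivity
  refine ⟨sphereArea d * A, mul_ne_zero (by exact_mod_cast (sphereArea_pos hd).ne')
    (by exact_mod_cast hA0), fun P hP => ?_⟩
  have hint : Integrable fun x => evalAt x P * gaussian d (1 / 2) x :=
    (polyMul P (gaussian d (1 / 2))).integrable.congr (ae_of_all _ fun x => polyMul_apply _ _ x)
  rw [gaussForm_apply, integral_polar hd hint, mul_assoc, hA, ← integral_complex_ofReal, ← integral_mul_const]
  congr 1
  refine setIntegral_congr_fun measurableSet_Ioi fun r hr => ?_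
  have h3 : ∀ ζ : S d, ‖r • (ζ : E d)‖ = r := fun ζ => by
    rw [norm_smul, norm_eq_of_mem_sphere, mul_one, Real.norm_of_nonneg (Set.mem_Ioi.1 hr).le]
  simp only [evalAt_smul hP, gaussian_apply one_half_pos, h3, integral_mul_const, integral_const_mul]
  push_cast
  ring

theorem pderiv_comm {d : ℕ} (i j : Fin d) (P : MvPolynomial (Fin d) ℂ) :
    pderiv i (pderiv j P) = pderiv j (pderiv i P) := by
  induction P using MvPolynomial.induction_on with
  | C a => simp
  | add P Q hP hQ => simp [hP, hQ]
  | mul_X P k hP =>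
    have h : ∀ a c : Fin d, pderiv a (pderiv c (X k : MvPolynomial (Fin d) ℂ)) = 0 := fun a c => by
      rw [MvPolynomial.pderiv_X, Pi.single_apply]
      split_ifs <;> simp
    simp only [Derivation.leibniz, map_add, smul_eq_mul, hP, h]
    ring

theorem pderiv_of_isHomogeneous_zero {d : ℕ} {P : MvPolynomial (Fin d) ℂ} (hP : P.IsHomogeneous 0)
    (i : Fin d) : pderiv i P = 0 := by
  rw [← MvPolynomial.totalDegree_zero_iff_isHomogeneous,
    MvPolynomial.totalDegree_eq_zero_iff_eq_C] at hP
  rw [hP, MvPolynomial.pderiv_C]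

/-- Green's formula for the Gaussian weight: for homogeneous `P`, `q` with `q` harmonic,
`(deg P - deg q) ∫ q P = ∫ q ΔP`. -/
theorem gaussForm_green {d m k : ℕ} {q P : MvPolynomial (Fin d) ℂ} (hq : q ∈ harmonicPoly d m)
    (hP : P.IsHomogeneous k) :
    ((k : ℂ) - m) * gaussForm d (q * P) = gaussForm d (q * ∑ i, pderiv i (pderiv i P)) := by
  rw [mem_harmonicPoly] at hq
  have h1 : ∀ i, gaussForm d (q * pderiv i (pderiv i P)) - gaussForm d (P * pderiv i (pderiv i q)) =
      gaussForm d (q * (X i * pderiv i P)) - gaussForm d (P * (X i * pderiv i q)) := fun i => by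
    have := gaussForm_pderiv (q * pderiv i P - P * pderiv i q) i
    rw [← map_sub, ← map_sub]
    convert this using 2
    · simp only [map_sub, Derivation.leibniz, smul_eq_mul]; ring
    · ring
  have h2 := Finset.sum_congr rfl fun i (_ : i ∈ Finset.univ) => h1 i
  simp only [Finset.sum_sub_distrib, ← map_sum, ← Finset.mul_sum, hq.1.sum_X_mul_pderiv, hq.2,
    hP.sum_X_mul_pderiv, mul_zero, map_zero, sub_zero, mul_smul_comm, map_nsmul] at h2
  rw [h2, mul_comm P q]
  simp only [nsmul_eq_mul]
  ring

/-- A harmonic homogeneous polynomial is orthogonal on the sphere to every homogeneous polynomial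
of smaller degree. -/
theorem sphere_integral_harmonic_mul {d m : ℕ} (hd : 2 ≤ d) {q : MvPolynomial (Fin d) ℂ}
    (hq : q ∈ harmonicPoly d m) {k : ℕ} (hk : k < m) {P : MvPolynomial (Fin d) ℂ}
    (hP : P.IsHomogeneous k) :
    ∫ ζ : S d, evalAt (ζ : E d) q * evalAt (ζ : E d) P ∂sphereMeasure d = 0 := by
  suffices h : gaussForm d (q * P) = 0 by
    obtain ⟨γ, hγ, h1⟩ := gaussForm_eq_sphere hd (m + k)
    rw [h1 _ (IsHomogeneous.mul ((mem_harmonicPoly q).1 hq).1 hP)] at h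
    simpa [hγ, evalAt_mul] using h
  induction k using Nat.strong_induction_on generalizing P with
  | _ k ih =>
    have h1 := gaussForm_green hq hP
    have h2 : gaussForm d (q * ∑ i, pderiv i (pderiv i P)) = 0 := by
      rcases Nat.eq_zero_or_pos k with h0 | h0
      · subst h0
        simp [pderiv_of_isHomogeneous_zero hP]
      · exact ih (k - 1 - 1) (by omega) (by omega)
          (IsHomogeneous.sum _ _ _ fun i _ => hP.pderiv.pderiv)
    rw [h2, mul_eq_zero, sub_eq_zero] at h1
    exact h1.resolve_left (by exact_mod_cast hk.ne)

theorem sphere_integral_harmonic_mul_harmonic {d m k : ℕ} (hd : 2 ≤ d) (hmk : m ≠ k)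
    {q P : MvPolynomial (Fin d) ℂ} (hq : q ∈ harmonicPoly d m) (hP : P ∈ harmonicPoly d k) :
    ∫ ζ : S d, evalAt (ζ : E d) q * evalAt (ζ : E d) P ∂sphereMeasure d = 0 := by
  rcases lt_or_gt_of_ne hmk with h | h
  · simp only [mul_comm (evalAt _ q)]
    exact sphere_integral_harmonic_mul hd hP h ((mem_harmonicPoly q).1 hq).1
  · exact sphere_integral_harmonic_mul hd hq h ((mem_harmonicPoly P).1 hP).1

theorem eq_zero_of_integral_conj_mul_self {d : ℕ} {F : S d → ℂ} (hF : Continuous F)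
    (h : ∫ ζ, starRingEnd ℂ (F ζ) * F ζ ∂sphereMeasure d = 0) (ζ : S d) : F ζ = 0 := by
  have h1 : ∀ z : ℂ, starRingEnd ℂ z * z = ((‖z‖ ^ 2 : ℝ) : ℂ) := fun z => by
    rw [Complex.conj_mul']; simp
  simp only [h1] at h
  rw [integral_complex_ofReal, Complex.ofReal_eq_zero] at h
  have hc : Continuous fun ζ : S d => ‖F ζ‖ ^ 2 := hF.norm.pow 2
  rw [integral_eq_zero_iff_of_nonneg (fun ζ => by positivity)
    (hc.integrable_of_hasCompactSupport (HasCompactSupport.of_compactSpace _)),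
    hc.ae_eq_iff_eq _ continuous_zero] at h
  simpa using congrFun h ζ

/-- The polynomial `|x|² = ∑ x_i²`. -/
def normSqPoly (d : ℕ) : MvPolynomial (Fin d) ℂ := ∑ i, X i ^ 2

theorem normSqPoly_isHomogeneous (d : ℕ) : (normSqPoly d).IsHomogeneous 2 :=
  IsHomogeneous.sum _ _ _ fun i _ => by
    simpa using (MvPolynomial.isHomogeneous_X ℂ i).pow 2

theorem evalAt_normSqPoly_sphere {d : ℕ} (ζ : S d) : evalAt (ζ : E d) (normSqPoly d) = 1 := by
  have h : ‖(ζ : E d)‖ ^ 2 = 1 := by rw [norm_eq_of_mem_sphere, one_pow]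
  rw [EuclideanSpace.norm_sq_eq] at h
  simp only [normSqPoly, map_sum, pow_two, evalAt_mul, evalAt_X]
  simp only [Real.norm_eq_abs, sq_abs] at h
  exact_mod_cast (by simpa [pow_two] using h : ∑ i, (ζ : E d) i * (ζ : E d) i = 1)

theorem polyLaplacian_apply {d : ℕ} (P : MvPolynomial (Fin d) ℂ) :
    polyLaplacian d P = ∑ i, pderiv i (pderiv i P) := by
  simp [polyLaplacian]

/-- Every homogeneous polynomial is, up to a multiple of `|x|²`, harmonic: `w ↦ Δ(|x|² w)` is
injective, hence bijective, on homogeneous polynomials of a given degree. -/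
theorem exists_harmonic_add_normSq_mul {d : ℕ} (hd : 2 ≤ d) {k : ℕ} {P : MvPolynomial (Fin d) ℂ}
    (hP : P.IsHomogeneous (k + 2)) :
    ∃ h ∈ harmonicPoly d (k + 2), ∃ w : MvPolynomial (Fin d) ℂ, w.IsHomogeneous k ∧
      P = h + normSqPoly d * w := by
  have hlap : ∀ Q : MvPolynomial (Fin d) ℂ, Q.IsHomogeneous (k + 2) →
      (polyLaplacian d Q).IsHomogeneous k := fun Q hQ => by
    rw [polyLaplacian_apply]
    exact IsHomogeneous.sum _ _ _ fun i _ => (hQ.pderiv (i := i)).pderiv (i := i)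
  have hmul : ∀ w : MvPolynomial (Fin d) ℂ, w.IsHomogeneous k →
      (normSqPoly d * w).IsHomogeneous (k + 2) := fun w hw => by
    rw [add_comm]; exact (normSqPoly_isHomogeneous d).mul hw
  let V := MvPolynomial.homogeneousSubmodule (Fin d) ℂ k
  have : FiniteDimensional ℂ V :=
    Module.Finite.iff_fg.mpr (MvPolynomial.homogeneousSubmodule_fg (Fin d) ℂ k)
  let T : V →ₗ[ℂ] V := (polyLaplacian d ∘ₗ LinearMap.mulLeft ℂ (normSqPoly d)).restrict
    (p := V) (q := V) fun w hw => by
      rw [MvPolynomial.mem_homogeneousSubmodule] at hw ⊢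
      exact hlap _ (hmul w hw)
  have hT : Function.Injective T := by
    rw [← LinearMap.ker_eq_bot, LinearMap.ker_eq_bot']
    intro w hw
    have hw1 : (w : MvPolynomial (Fin d) ℂ).IsHomogeneous k := w.2
    have hw2 : polyLaplacian d (normSqPoly d * w) = 0 := congrArg Subtype.val hw
    have hw3 : normSqPoly d * w ∈ harmonicPoly d (k + 2) := ⟨hmul _ hw1, hw2⟩
    have h1 := sphere_integral_harmonic_mul hd hw3 (by omega : k < k + 2)
      (P := conjPoly w) (hw1.map _)
    refine Subtype.ext (eq_zero_of_sphere hd hw1 ?_)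
    refine eq_zero_of_integral_conj_mul_self (continuous_evalAt_sphere _) ?_
    rw [← h1]
    congr 1; ext ζ
    rw [evalAt_mul, evalAt_normSqPoly_sphere, evalAt_conjPoly, one_mul, mul_comm]
  obtain ⟨w, hw⟩ := LinearMap.injective_iff_surjective.1 hT ⟨polyLaplacian d P, hlap P hP⟩
  have hw1 : (w : MvPolynomial (Fin d) ℂ).IsHomogeneous k := w.2
  have hw2 : polyLaplacian d (normSqPoly d * w) = polyLaplacian d P := congrArg Subtype.val hw
  refine ⟨P - normSqPoly d * w, ⟨?_, ?_⟩, w, hw1, by ring⟩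
  · exact Submodule.sub_mem _ hP (hmul _ hw1)
  · rw [SetLike.mem_coe, LinearMap.mem_ker, map_sub, hw2, sub_self]

section Completeness

variable {d : ℕ} {ψ : S d → ℂ}

/-- On the sphere `|x|² = 1`, so every homogeneous polynomial restricts to a sum of harmonic ones. -/
theorem integral_mul_homogeneous_eq_zero (hd : 2 ≤ d) (hψ : Continuous ψ)
    (h : ∀ m, ∀ q ∈ harmonicPoly d m, ∫ ζ, ψ ζ * evalAt (ζ : E d) q ∂sphereMeasure d = 0)
    (k : ℕ) : ∀ P : MvPolynomial (Fin d) ℂ, P.IsHomogeneous k →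
      ∫ ζ, ψ ζ * evalAt (ζ : E d) P ∂sphereMeasure d = 0 := by
  induction k using Nat.twoStepInduction with
  | zero =>
    intro P hP
    exact h 0 P ((mem_harmonicPoly P).2 ⟨hP, by simp [pderiv_of_isHomogeneous_zero hP]⟩)
  | one =>
    intro P hP
    exact h 1 P ((mem_harmonicPoly P).2
      ⟨hP, by simp [pderiv_of_isHomogeneous_zero (hP.pderiv (i := _))]⟩)
  | more k ih _ =>
    intro P hP
    obtain ⟨q, hq, w, hw, rfl⟩ := exists_harmonic_add_normSq_mul hd hP
    simp only [map_add, evalAt_mul, evalAt_normSqPoly_sphere, one_mul, mul_add]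
    rw [integral_add, h _ q hq, ih w hw, add_zero]
    · exact integrable_sphere (hψ.mul (continuous_evalAt_sphere _))
    · exact integrable_sphere (hψ.mul (continuous_evalAt_sphere _))

theorem integral_mul_evalAt_eq_zero (hd : 2 ≤ d) (hψ : Continuous ψ)
    (h : ∀ m, ∀ q ∈ harmonicPoly d m, ∫ ζ, ψ ζ * evalAt (ζ : E d) q ∂sphereMeasure d = 0)
    (P : MvPolynomial (Fin d) ℂ) : ∫ ζ, ψ ζ * evalAt (ζ : E d) P ∂sphereMeasure d = 0 := by
  rw [← MvPolynomial.sum_homogeneousComponent P]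
  simp only [map_sum, Finset.mul_sum]
  rw [integral_finsetSum]
  swap
  · exact fun k _ => integrable_sphere (hψ.mul (continuous_evalAt_sphere _))
  exact Finset.sum_eq_zero fun k _ => integral_mul_homogeneous_eq_zero hd hψ h k _
    (MvPolynomial.homogeneousComponent_isHomogeneous k P)

/-- By the Stone–Weierstrass theorem, orthogonality to polynomials passes to continuous functions. -/
theorem integral_mul_ofReal_eq_zero (hd : 2 ≤ d) (hψ : Continuous ψ)
    (h : ∀ m, ∀ q ∈ harmonicPoly d m, ∫ ζ, ψ ζ * evalAt (ζ : E d) q ∂sphereMeasure d = 0)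
    {g : S d → ℝ} (hg : Continuous g) : ∫ ζ, ψ ζ * (g ζ : ℂ) ∂sphereMeasure d = 0 := by
  let coord : Fin d → C(S d, ℝ) := fun i => ⟨fun ζ => (ζ : E d) i, by fun_prop⟩
  let A : Subalgebra ℝ C(S d, ℝ) := (MvPolynomial.aeval coord).range
  have hA : A.SeparatesPoints := by
    intro x y hxy
    by_contra hcon
    push Not at hcon
    apply hxy
    ext i
    exact hcon (coord i) ⟨coord i, ⟨X i, by simp⟩, rfl⟩
  have hpoly : ∀ p ∈ A, ∫ ζ, ψ ζ * ((p ζ : ℝ) : ℂ) ∂sphereMeasure d = 0 := by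
    rintro _ ⟨P, rfl⟩
    have h1 : ∀ ζ : S d, (((MvPolynomial.aeval coord P : C(S d, ℝ)) ζ : ℝ) : ℂ) =
        evalAt (ζ : E d) (MvPolynomial.map Complex.ofRealHom P) := fun ζ => by
      induction P using MvPolynomial.induction_on with
      | C a => simp [evalAt_apply]
      | add P Q hP hQ => simp [hP, hQ]
      | mul_X P i hP => simp [hP, evalAt_mul, evalAt_X, coord]
    have h2 := integral_mul_evalAt_eq_zero hd hψ h (MvPolynomial.map Complex.ofRealHom P)
    simp only [← h1] at h2
    exact h2
  have hint : ∀ {u : S d → ℝ}, Continuous u →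
      Integrable (fun ζ => ψ ζ * (u ζ : ℂ)) (sphereMeasure d) := fun hu =>
    integrable_sphere (hψ.mul (Complex.continuous_ofReal.comp hu))
  obtain ⟨B, hB⟩ := isCompact_univ.exists_bound_of_continuousOn (hψ.continuousOn (s := Set.univ))
  have hle : ∀ ε > 0, ‖∫ ζ, ψ ζ * (g ζ : ℂ) ∂sphereMeasure d‖ ≤ (|B| + 1) * ε := by
    intro ε hε
    obtain ⟨p, hp⟩ := ContinuousMap.exists_mem_subalgebra_near_continuous_of_separatesPoints
      A hA g hg ε hε
    have h1 : ∫ ζ, ψ ζ * (g ζ : ℂ) ∂sphereMeasure d =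
        ∫ ζ, (ψ ζ * (g ζ : ℂ) - ψ ζ * (((p : C(S d, ℝ)) ζ : ℝ) : ℂ)) ∂sphereMeasure d := by
      rw [integral_sub (hint hg) (hint (p : C(S d, ℝ)).continuous), hpoly p p.2, sub_zero]
    rw [h1]
    refine norm_sphere_integral_le hd fun ζ => ?_
    rw [← mul_sub, norm_mul, ← Complex.ofReal_sub, Complex.norm_real]
    have h2 := hp ζ
    rw [norm_sub_rev] at h2
    have h3 := (hB ζ (Set.mem_univ _)).trans (le_abs_self B)
    gcongr
    linarith
  have : ‖∫ ζ, ψ ζ * (g ζ : ℂ) ∂sphereMeasure d‖ ≤ 0 := by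
    refine le_of_forall_pos_le_add fun ε hε => ?_
    refine (hle (ε / (|B| + 1)) (by positivity)).trans ?_
    rw [mul_div_cancel₀ _ (by positivity), zero_add]
  exact norm_le_zero_iff.1 this

/-- Completeness of spherical harmonics: a continuous function on the sphere orthogonal to all of
them vanishes. -/
theorem eq_zero_of_orthogonal_harmonics (hd : 2 ≤ d) (hψ : Continuous ψ)
    (h : ∀ m, ∀ q ∈ harmonicPoly d m, ∫ ζ, ψ ζ * evalAt (ζ : E d) q ∂sphereMeasure d = 0)
    (ζ : S d) : ψ ζ = 0 := by
  have hre := integral_mul_ofReal_eq_zero hd hψ h (Complex.continuous_re.comp hψ)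
  have him := integral_mul_ofReal_eq_zero hd hψ h (Complex.continuous_im.comp hψ)
  refine eq_zero_of_integral_conj_mul_self hψ ?_ ζ
  have h1 : ∀ ζ, starRingEnd ℂ (ψ ζ) * ψ ζ =
      ψ ζ * ((ψ ζ).re : ℂ) - Complex.I * (ψ ζ * ((ψ ζ).im : ℂ)) := fun ζ => by
    have : starRingEnd ℂ (ψ ζ) = (ψ ζ).re - Complex.I * (ψ ζ).im := by
      apply Complex.ext <;> simp
    rw [this]; ring
  simp only [h1]
  rw [integral_sub, integral_const_mul]
  · simp only [Function.comp] at hre him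
    rw [hre, him]; simp
  · exact integrable_sphere (hψ.mul (by fun_prop))
  · exact integrable_sphere (continuous_const.mul (hψ.mul (by fun_prop)))

end Completeness

/-! ### The Fourier transform of a harmonic polynomial times a Gaussian -/

/-- Hecke's identity: up to a constant, the Fourier transform maps a harmonic polynomial times a
Gaussian to the same polynomial times the dual Gaussian. -/
theorem fourier_polyMul_gaussian {d : ℕ} {b : ℝ} (hb : 0 < b) (m : ℕ) :
    ∀ q ∈ harmonicPoly d m, 𝓕 (polyMul q (gaussian d b)) =
      ((-Complex.I * Real.pi / b) ^ m * (Real.pi / b : ℂ) ^ (d / 2 : ℂ)) •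
        polyMul q (gaussian d (Real.pi ^ 2 / b)) := by
  have hb' : 0 < Real.pi ^ 2 / b := by positivity
  have hπ : (Real.pi : ℂ) ≠ 0 := by exact_mod_cast Real.pi_ne_zero
  have hbc : (b : ℂ) ≠ 0 := by exact_mod_cast hb.ne'
  induction m with
  | zero =>
    intro q hq
    have hq1 := ((mem_harmonicPoly q).1 hq).1
    rw [← MvPolynomial.totalDegree_zero_iff_isHomogeneous,
      MvPolynomial.totalDegree_eq_zero_iff_eq_C] at hq1
    have h1 : ∀ f : 𝓢(E d, ℂ), polyMul q f = q.coeff 0 • f := fun f => by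
      ext x
      rw [polyMul_apply, hq1, evalAt_C]
      simp
    rw [h1, h1, FourierTransform.fourier_smul, fourier_gaussian hb, smul_smul, smul_smul, pow_zero]
    congr 1; ring
  | succ m ih =>
    intro q hq
    rw [mem_harmonicPoly] at hq
    have hpd : ∀ i, pderiv i q ∈ harmonicPoly d m := fun i => by
      rw [mem_harmonicPoly]
      refine ⟨hq.1.pderiv, ?_⟩
      have h2 := congrArg (pderiv i) hq.2
      rw [map_sum, map_zero] at h2
      rw [← h2]
      refine Finset.sum_congr rfl fun j _ => ?_
      rw [pderiv_comm j i, pderiv_comm j i]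
    -- Euler's identity reduces `q` to its partial derivatives, which are harmonic of degree `m`
    have hE : ∀ f : 𝓢(E d, ℂ), ((m + 1 : ℕ) : ℂ) • polyMul q f =
        ∑ i, polyMul (X i) (polyMul (pderiv i q) f) := fun f => by
      ext x
      have h3 := congrArg (evalAt x) hq.1.sum_X_mul_pderiv
      simp only [map_sum, evalAt_mul, map_nsmul] at h3
      rw [nsmul_eq_mul] at h3
      simp only [smul_apply, sum_apply, polyMul_apply, smul_eq_mul, ← mul_assoc]
      rw [← Finset.sum_mul, h3]
    have hm : ((m + 1 : ℕ) : ℂ) ≠ 0 := by exact_mod_cast Nat.succ_ne_zero m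
    suffices key : ((m + 1 : ℕ) : ℂ) • 𝓕 (polyMul q (gaussian d b)) = ((m + 1 : ℕ) : ℂ) •
        ((-Complex.I * Real.pi / b) ^ (m + 1) * (Real.pi / b : ℂ) ^ (d / 2 : ℂ)) •
          polyMul q (gaussian d (Real.pi ^ 2 / b)) from smul_right_injective _ hm key
    rw [← FourierTransform.fourier_smul, hE, FourierTransform.fourier_sum]
    simp only [fourier_polyMul_X, ih _ (hpd _)]
    ext x
    simp only [smul_apply, sum_apply, LineDeriv.lineDerivOp_smul, lineDeriv_polyMul, add_apply,
      polyMul_apply, lineDeriv_gaussian_apply hb', smul_eq_mul]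
    have h4 := congrArg (evalAt x) hq.1.sum_X_mul_pderiv
    have h5 := congrArg (evalAt x) hq.2
    simp only [map_sum, evalAt_mul, map_nsmul, evalAt_X, map_zero] at h4 h5
    rw [nsmul_eq_mul] at h4
    simp only [← Finset.mul_sum, Finset.sum_add_distrib, ← Finset.sum_mul, h5]
    have h6 : ∑ i, evalAt x (pderiv i q) *
        (-2 * ((Real.pi ^ 2 / b : ℝ) : ℂ) * x i * gaussian d (Real.pi ^ 2 / b) x) =
        -2 * ((Real.pi ^ 2 / b : ℝ) : ℂ) * (((m + 1 : ℕ) : ℂ) * evalAt x q) *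
          gaussian d (Real.pi ^ 2 / b) x := by
      rw [← h4, Finset.mul_sum, Finset.sum_mul]
      exact Finset.sum_congr rfl fun i _ => by ring
    rw [h6, pow_succ (-Complex.I * Real.pi / b : ℂ) m]
    generalize (-Complex.I * Real.pi / b : ℂ) ^ m = a₁
    generalize (Real.pi / b : ℂ) ^ (d / 2 : ℂ) = a₂
    generalize gaussian d (Real.pi ^ 2 / b) x = w
    push_cast
    field_simp
    ring

/-! ### Taylor expansion at the origin -/

/-- Taylor's formula for `e^{is}`, with a remainder bounded uniformly in `s`. -/
theorem exists_norm_exp_sub_le (n : ℕ) : ∃ K : ℝ, 0 ≤ K ∧ ∀ s : ℝ,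
    ‖Complex.exp (s * Complex.I) - ∑ k ∈ Finset.range n, (s * Complex.I) ^ k / k.factorial‖ ≤
      K * |s| ^ n := by
  have hn : ∀ s : ℝ, ‖(s : ℂ) * Complex.I‖ = |s| := fun s => by simp
  refine ⟨Real.exp 1 + (1 + n), by positivity, fun s => ?_⟩
  rcases le_total |s| 1 with h | h
  · refine (Complex.norm_exp_sub_sum_le_norm_mul_exp _ n).trans ?_
    rw [hn, mul_comm]
    gcongr
    have h1 : Real.exp |s| ≤ Real.exp 1 := Real.exp_le_exp.2 h
    have : (0 : ℝ) ≤ n := n.cast_nonneg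
    linarith
  · have h1 : ‖∑ k ∈ Finset.range n, ((s : ℂ) * Complex.I) ^ k / k.factorial‖ ≤ n * |s| ^ n := by
      refine (norm_sum_le _ _).trans ?_
      calc _ ≤ ∑ k ∈ Finset.range n, |s| ^ n := Finset.sum_le_sum fun k hk => by
            rw [norm_div, norm_pow, hn, Complex.norm_natCast]
            refine (div_le_self (by positivity) (by exact_mod_cast k.factorial_pos)).trans ?_
            exact pow_le_pow_right₀ h (Finset.mem_range.1 hk).le
        _ = n * |s| ^ n := by simp
    refine (norm_sub_le _ _).trans ?_
    rw [Complex.norm_exp_ofReal_mul_I]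
    have h2 : 1 ≤ |s| ^ n := one_le_pow₀ h
    have h3 := mul_nonneg (Real.exp_pos 1).le (pow_nonneg (abs_nonneg s) n)
    linarith

variable {d : ℕ}

/-- The partial derivative `∂^α f` of a Schwartz function, as a Schwartz function. -/
def multiPartial (α : Fin d → ℕ) (f : 𝓢(E d, ℂ)) : 𝓢(E d, ℂ) :=
  (List.finRange d).foldr (fun i g => (fun u : 𝓢(E d, ℂ) => ∂_{stdVec i} u)^[α i] g) f

theorem partialD_coe (i : Fin d) (g : 𝓢(E d, ℂ)) : partialD i g = ⇑(∂_{stdVec i} g : 𝓢(E d, ℂ)) := by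
  ext x
  rw [lineDerivOp_apply_eq_fderiv]
  rfl

theorem multiPartialD_coe (α : Fin d → ℕ) (f : 𝓢(E d, ℂ)) :
    multiPartialD α f = ⇑(multiPartial α f) := by
  have hiter : ∀ (i : Fin d) (n : ℕ) (g : 𝓢(E d, ℂ)),
      (partialD i)^[n] g = ⇑((fun u : 𝓢(E d, ℂ) => ∂_{stdVec i} u)^[n] g) := by
    intro i n
    induction n with
    | zero => intro g; rfl
    | succ n ih => intro g; rw [Function.iterate_succ_apply, Function.iterate_succ_apply,
        partialD_coe, ih]
  rw [multiPartialD, multiPartial]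
  induction List.finRange d with
  | nil => rfl
  | cons i l ih => rw [List.foldr_cons, List.foldr_cons, ih, hiter]

theorem polyMul_mul (P Q : MvPolynomial (Fin d) ℂ) (f : 𝓢(E d, ℂ)) :
    polyMul (P * Q) f = polyMul P (polyMul Q f) := by
  ext x; simp [evalAt_mul, mul_assoc]

theorem fourier_multiPartial (α : Fin d → ℕ) (f : 𝓢(E d, ℂ)) :
    𝓕 (multiPartial α f) =
      polyMul (∏ i, (C (2 * Real.pi * Complex.I) * X i) ^ α i) (𝓕 f) := by
  have hone : ∀ f : 𝓢(E d, ℂ), polyMul 1 f = f := fun f => by ext x; simp [evalAt_apply]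
  have hiter : ∀ (i : Fin d) (n : ℕ) (g : 𝓢(E d, ℂ)),
      𝓕 ((fun u : 𝓢(E d, ℂ) => ∂_{stdVec i} u)^[n] g) =
        polyMul ((C (2 * Real.pi * Complex.I) * X i) ^ n) (𝓕 g) := by
    intro i n g
    induction n with
    | zero => rw [pow_zero, hone]; rfl
    | succ n ih =>
      rw [Function.iterate_succ_apply', fourier_lineDeriv, ih, pow_succ']
      ext x
      simp [evalAt_mul, evalAt_C, mul_assoc]
  rw [Fin.prod_univ_def, multiPartial]
  induction List.finRange d with
  | nil => rw [List.map_nil, List.prod_nil, hone]; rfl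
  | cons i l ih => rw [List.foldr_cons, hiter, ih, List.map_cons, List.prod_cons, polyMul_mul]

theorem schwartz_eq_integral_fourier (f : 𝓢(E d, ℂ)) (x : E d) :
    f x = ∫ v, Complex.exp ((2 * Real.pi * inner ℝ v x : ℝ) * Complex.I) * 𝓕 f v := by
  have h : 𝓕⁻ (𝓕 f) = f := FourierTransform.fourierInv_fourier_eq f
  conv_lhs => rw [← h]
  rw [fourierInv_coe, Real.fourierInv_eq']
  rfl

/-- The homogeneous part of degree `k` of the Taylor expansion of `f` at `0`. -/
def taylorPoly (f : E d → ℂ) (k : ℕ) : MvPolynomial (Fin d) ℂ :=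
  ∑ α ∈ (Finset.univ : Finset (Fin d)).piAntidiag k,
    C (multiPartialD α f 0 / ((∏ i, (α i).factorial : ℕ) : ℂ)) * ∏ i, X i ^ α i

theorem taylorPoly_isHomogeneous (f : E d → ℂ) (k : ℕ) : (taylorPoly f k).IsHomogeneous k := by
  refine IsHomogeneous.sum _ _ _ fun α hα => ?_
  have h1 : ∑ i, α i = k := (Finset.mem_piAntidiag.1 hα).1
  have h2 := (MvPolynomial.isHomogeneous_C (Fin d)
    (multiPartialD α f 0 / ((∏ i, (α i).factorial : ℕ) : ℂ))).mul
    (IsHomogeneous.prod Finset.univ (fun i : Fin d => (X i : MvPolynomial (Fin d) ℂ) ^ α i) α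
      fun i _ => by simpa using (MvPolynomial.isHomogeneous_X ℂ i).pow (α i))
  rwa [zero_add, h1] at h2

theorem evalAt_prod_X_pow (x : E d) (α : Fin d → ℕ) :
    evalAt x (∏ i, (X i : MvPolynomial (Fin d) ℂ) ^ α i) = ∏ i, (x i : ℂ) ^ α i := by
  simp [evalAt_apply]

/-- The homogeneous Taylor polynomials of `f` arise by expanding the exponential in the Fourier
inversion formula. -/
theorem integral_pow_inner_mul_fourier (f : 𝓢(E d, ℂ)) (k : ℕ) (x : E d) :
    Integrable (fun v => ((2 * Real.pi * inner ℝ v x : ℝ) * Complex.I) ^ k / k.factorial *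
      𝓕 f v) ∧
    ∫ v, ((2 * Real.pi * inner ℝ v x : ℝ) * Complex.I) ^ k / k.factorial * 𝓕 f v =
      evalAt x (taylorPoly f k) := by
  set Q : (Fin d → ℕ) → MvPolynomial (Fin d) ℂ :=
    fun α => ∏ i, (C (2 * Real.pi * Complex.I) * X i) ^ α i with hQ
  have hterm : ∀ v : E d,
      ((2 * Real.pi * inner ℝ v x : ℝ) * Complex.I) ^ k / k.factorial * 𝓕 f v =
      ∑ α ∈ (Finset.univ : Finset (Fin d)).piAntidiag k,
        (∏ i, (x i : ℂ) ^ α i) / ((∏ i, (α i).factorial : ℕ) : ℂ) * polyMul (Q α) (𝓕 f) v := by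
    intro v
    have h1 : ((2 * Real.pi * inner ℝ v x : ℝ) : ℂ) * Complex.I =
        ∑ i, (2 * Real.pi * Complex.I * v i) * x i := by
      rw [PiLp.inner_apply]
      push_cast
      rw [Finset.mul_sum, Finset.sum_mul]
      refine Finset.sum_congr rfl fun i _ => ?_
      simp
      ring
    rw [h1, Finset.sum_pow_eq_sum_piAntidiag, Finset.sum_div, Finset.sum_mul]
    refine Finset.sum_congr rfl fun α hα => ?_
    have h2 : ∑ i, α i = k := (Finset.mem_piAntidiag.1 hα).1
    have h3 := Nat.multinomial_spec Finset.univ α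
    rw [h2] at h3
    have h4 : ((∏ i, (α i).factorial : ℕ) : ℂ) * (Nat.multinomial Finset.univ α : ℂ) =
        (k.factorial : ℂ) := by exact_mod_cast h3
    have h5 : ((∏ i, (α i).factorial : ℕ) : ℂ) ≠ 0 := by
      exact_mod_cast Finset.prod_ne_zero_iff.2 fun i _ => (α i).factorial_ne_zero
    have h6 : (k.factorial : ℂ) ≠ 0 := by exact_mod_cast k.factorial_ne_zero
    have h7 : evalAt v (Q α) = ∏ i, (2 * Real.pi * Complex.I * v i) ^ α i := by
      simp [hQ, evalAt_apply]
    rw [polyMul_apply, h7]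
    simp only [mul_pow, Finset.prod_mul_distrib] at *
    rw [← h4] at h6 ⊢
    have h8 := right_ne_zero_of_mul h6
    field_simp
  have hint : ∀ α ∈ (Finset.univ : Finset (Fin d)).piAntidiag k, Integrable fun v =>
      (∏ i, (x i : ℂ) ^ α i) / ((∏ i, (α i).factorial : ℕ) : ℂ) * polyMul (Q α) (𝓕 f) v :=
    fun α _ => (polyMul (Q α) (𝓕 f)).integrable.const_mul _
  simp only [hterm]
  refine ⟨integrable_finsetSum _ hint, ?_⟩
  rw [integral_finsetSum _ hint, taylorPoly, map_sum]
  refine Finset.sum_congr rfl fun α _ => ?_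
  rw [integral_const_mul, evalAt_mul, evalAt_C, evalAt_prod_X_pow, multiPartialD_coe,
    schwartz_eq_integral_fourier (multiPartial α f) 0, fourier_multiPartial]
  simp only [inner_zero_right, mul_zero, Complex.ofReal_zero, zero_mul, Complex.exp_zero, one_mul]
  ring

/-- Taylor's formula at `0`, obtained from the expansion of the exponential in Fourier inversion. -/
theorem exists_taylor_bound (f : 𝓢(E d, ℂ)) (n : ℕ) : ∃ K : ℝ, 0 ≤ K ∧ ∀ x : E d,
    ‖f x - ∑ k ∈ Finset.range n, evalAt x (taylorPoly f k)‖ ≤ K * ‖x‖ ^ n := by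
  obtain ⟨K, hK0, hK⟩ := exists_norm_exp_sub_le n
  have hi : Integrable fun v : E d => ‖v‖ ^ n * ‖𝓕 f v‖ := (𝓕 f).integrable_pow_mul volume n
  refine ⟨K * (2 * Real.pi) ^ n * ∫ v, ‖v‖ ^ n * ‖𝓕 f v‖,
    mul_nonneg (by positivity) (integral_nonneg fun v => by positivity), fun x => ?_⟩
  have hexp : Integrable fun v =>
      Complex.exp ((2 * Real.pi * inner ℝ v x : ℝ) * Complex.I) * 𝓕 f v := by
    refine (𝓕 f).integrable.bdd_mul (c := 1) (Continuous.aestronglyMeasurable (by fun_prop)) ?_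
    exact ae_of_all _ fun v => (Complex.norm_exp_ofReal_mul_I _).le
  have h1 : f x - ∑ k ∈ Finset.range n, evalAt x (taylorPoly f k) =
      ∫ v, (Complex.exp ((2 * Real.pi * inner ℝ v x : ℝ) * Complex.I) -
        ∑ k ∈ Finset.range n, ((2 * Real.pi * inner ℝ v x : ℝ) * Complex.I) ^ k / k.factorial) *
          𝓕 f v := by
    simp only [sub_mul, Finset.sum_mul]
    rw [integral_sub hexp (integrable_finsetSum _ fun k _ =>
      (integral_pow_inner_mul_fourier f k x).1), integral_finsetSum _ fun k _ =>
      (integral_pow_inner_mul_fourier f k x).1, ← schwartz_eq_integral_fourier]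
    simp only [(integral_pow_inner_mul_fourier f _ x).2]
  rw [h1]
  refine (norm_integral_le_of_norm_le (g := fun v => K * (2 * Real.pi) ^ n * ‖x‖ ^ n *
    (‖v‖ ^ n * ‖𝓕 f v‖)) (hi.const_mul _) (ae_of_all _ fun v => ?_)).trans_eq ?_
  · rw [norm_mul]
    have h2 : |2 * Real.pi * inner ℝ v x| ≤ 2 * Real.pi * (‖v‖ * ‖x‖) := by
      rw [abs_mul, abs_of_pos Real.two_pi_pos]
      gcongr
      exact abs_real_inner_le_norm v x
    calc _ ≤ K * |2 * Real.pi * inner ℝ v x| ^ n * ‖𝓕 f v‖ := by gcongr; exact hK _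
      _ ≤ K * (2 * Real.pi * (‖v‖ * ‖x‖)) ^ n * ‖𝓕 f v‖ := by gcongr
      _ = _ := by ring
  · rw [integral_const_mul]; ring

/-! ### The radial profile of a harmonic component and its Fourier transform -/

/-- The radial profile of the component of `f` along the harmonic polynomial `q` of degree `m`:
`r ↦ r⁻ᵐ ∫_S f(rζ) q(ζ) dζ`, with its limit value at `r = 0`. -/
def profile (m : ℕ) (q : MvPolynomial (Fin d) ℂ) (f : E d → ℂ) (r : ℝ) : ℂ :=
  sphereIntegral m f (fun ζ => evalAt ζ q) r

theorem profile_of_ne_zero {m : ℕ} {q : MvPolynomial (Fin d) ℂ} (hq : q.IsHomogeneous m)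
    (f : E d → ℂ) {r : ℝ} (hr : r ≠ 0) :
    profile m q f r =
      ((r : ℂ) ^ m)⁻¹ * ∫ ζ : S d, f (r • (ζ : E d)) * evalAt (ζ : E d) q ∂sphereMeasure d := by
  rw [profile, sphereIntegral, if_neg hr, ← integral_const_mul]
  congr 1; ext ζ
  rw [evalAt_smul hq]
  push_cast
  rw [inv_pow]
  ring

theorem profile_zero {m : ℕ} {q : MvPolynomial (Fin d) ℂ} (f : E d → ℂ) :
    profile m q f 0 =
      ∫ ζ : S d, evalAt (ζ : E d) (taylorPoly f m) * evalAt (ζ : E d) q ∂sphereMeasure d := by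
  have h1 : ∀ α : Fin d → ℕ, Continuous fun ζ : S d =>
      evalAt (ζ : E d) (∏ i, (X i : MvPolynomial (Fin d) ℂ) ^ α i) * evalAt (ζ : E d) q :=
    fun α => (continuous_evalAt_sphere _).mul (continuous_evalAt_sphere _)
  rw [profile, sphereIntegral, if_pos rfl, taylorPoly]
  simp only [map_sum, evalAt_mul, evalAt_C, Finset.sum_mul, mul_assoc]
  rw [integral_finsetSum _ fun α _ => (integrable_sphere (h1 α)).const_mul _]
  refine Finset.sum_congr rfl fun α _ => ?_
  rw [integral_const_mul]
  simp only [evalAt_prod_X_pow]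

theorem exists_bound_evalAt_sphere (q : MvPolynomial (Fin d) ℂ) :
    ∃ B : ℝ, 0 ≤ B ∧ ∀ ζ : S d, ‖evalAt (ζ : E d) q‖ ≤ B := by
  obtain ⟨B, hB⟩ := isCompact_univ.exists_bound_of_continuousOn
    ((continuous_evalAt_sphere q).continuousOn (s := Set.univ))
  exact ⟨|B|, abs_nonneg B, fun ζ => (hB ζ (Set.mem_univ _)).trans (le_abs_self B)⟩

/-- Near the origin the profile differs from its value at `0` by `O(r)`: harmonic polynomials of
degree `m` are orthogonal to the Taylor polynomials of degree less than `m`. -/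
theorem exists_profile_sub_le (hd : 2 ≤ d) {m : ℕ} {q : MvPolynomial (Fin d) ℂ}
    (hq : q ∈ harmonicPoly d m) (f : 𝓢(E d, ℂ)) :
    ∃ K : ℝ, ∀ r, 0 < r → ‖profile m q f r - profile m q f 0‖ ≤ K * r := by
  obtain ⟨K, hK0, hK⟩ := exists_taylor_bound f (m + 1)
  obtain ⟨B, hB0, hB⟩ := exists_bound_evalAt_sphere q
  have hqh := ((mem_harmonicPoly q).1 hq).1
  refine ⟨K * B, fun r hr => ?_⟩
  have hrc : (r : ℂ) ^ m ≠ 0 := pow_ne_zero _ (by exact_mod_cast hr.ne')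
  have hci : ∀ k, Integrable (fun ζ : S d =>
      (r : ℂ) ^ k * (evalAt (ζ : E d) (taylorPoly f k) * evalAt (ζ : E d) q)) (sphereMeasure d) :=
    fun k => (integrable_sphere
      ((continuous_evalAt_sphere _).mul (continuous_evalAt_sphere _))).const_mul _
  have h0 : profile m q f 0 = ((r : ℂ) ^ m)⁻¹ * ∫ ζ : S d,
      (∑ k ∈ Finset.range (m + 1), evalAt (r • (ζ : E d)) (taylorPoly f k)) *
        evalAt (ζ : E d) q ∂sphereMeasure d := by
    simp only [Finset.sum_mul, evalAt_smul (taylorPoly_isHomogeneous f _), mul_assoc]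
    rw [integral_finsetSum _ fun k _ => hci k, Finset.sum_range_succ, Finset.sum_eq_zero,
      zero_add, integral_const_mul, ← mul_assoc, inv_mul_cancel₀ hrc, one_mul, profile_zero]
    intro k hk
    have := sphere_integral_harmonic_mul hd hq (Finset.mem_range.1 hk)
      (taylorPoly_isHomogeneous f k)
    simp only [mul_comm (evalAt _ q)] at this
    rw [integral_const_mul, this, mul_zero]
  have hc1 : Continuous fun ζ : S d => f (r • (ζ : E d)) * evalAt (ζ : E d) q :=
    (f.continuous.comp (by fun_prop)).mul (continuous_evalAt_sphere _)
  have hc2 : Continuous fun ζ : S d =>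
      (∑ k ∈ Finset.range (m + 1), evalAt (r • (ζ : E d)) (taylorPoly f k)) *
        evalAt (ζ : E d) q :=
    (continuous_finsetSum _ fun k _ => (continuous_evalAt _).comp (by fun_prop)).mul
      (continuous_evalAt_sphere _)
  rw [h0, profile_of_ne_zero hqh _ hr.ne', ← mul_sub,
    ← integral_sub (integrable_sphere hc1) (integrable_sphere hc2), norm_mul, norm_inv, norm_pow,
    Complex.norm_real, Real.norm_of_nonneg hr.le]
  have h1 : ‖∫ ζ : S d, (f (r • (ζ : E d)) * evalAt (ζ : E d) q -
      (∑ k ∈ Finset.range (m + 1), evalAt (r • (ζ : E d)) (taylorPoly f k)) *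
        evalAt (ζ : E d) q) ∂sphereMeasure d‖ ≤ K * r ^ (m + 1) * B := by
    refine norm_sphere_integral_le hd fun ζ => ?_
    rw [← sub_mul, norm_mul]
    have h2 := hK (r • (ζ : E d))
    rw [norm_smul, norm_eq_of_mem_sphere, mul_one, Real.norm_of_nonneg hr.le] at h2
    gcongr
    exact hB ζ
  calc _ ≤ (r ^ m)⁻¹ * (K * r ^ (m + 1) * B) := by gcongr
    _ = K * B * r := by field_simp; ring

/-- Continuity of the profile, including at radius `0`, where its value is given by the Taylor
polynomial. -/
theorem continuousOn_profile (hd : 2 ≤ d) {m : ℕ} {q : MvPolynomial (Fin d) ℂ}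
    (hq : q ∈ harmonicPoly d m) (f : 𝓢(E d, ℂ)) :
    ContinuousOn (profile m q f) (Set.Ici 0) := by
  have hqh := ((mem_harmonicPoly q).1 hq).1
  intro r hr
  rcases eq_or_lt_of_le (Set.mem_Ici.1 hr) with h0 | h0
  · subst h0
    obtain ⟨K, hK⟩ := exists_profile_sub_le hd hq f
    have h1 : ∀ r ∈ Set.Ici (0 : ℝ), ‖profile m q f r - profile m q f 0‖ ≤ K * r := by
      intro r hr
      rcases eq_or_lt_of_le (Set.mem_Ici.1 hr) with h | h
      · rw [← h]; simp
      · exact hK r h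
    rw [ContinuousWithinAt, tendsto_iff_norm_sub_tendsto_zero]
    refine squeeze_zero' (Eventually.of_forall fun _ => norm_nonneg _)
      (eventually_nhdsWithin_of_forall h1) ?_
    have : Tendsto (fun r : ℝ => K * r) (𝓝 0) (𝓝 (K * 0)) := tendsto_id.const_mul K
    rw [mul_zero] at this
    exact this.mono_left nhdsWithin_le_nhds
  · have hev : profile m q f =ᶠ[𝓝 r] fun r => ((r : ℂ) ^ m)⁻¹ *
        ∫ ζ : S d, f (r • (ζ : E d)) * evalAt (ζ : E d) q ∂sphereMeasure d := by
      filter_upwards [eventually_gt_nhds h0] with s hs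
      exact profile_of_ne_zero hqh _ hs.ne'
    refine ContinuousAt.continuousWithinAt (ContinuousAt.congr ?_ hev.symm)
    refine ContinuousAt.mul (ContinuousAt.inv₀ (by fun_prop)
      (pow_ne_zero _ (by exact_mod_cast h0.ne'))) (Continuous.continuousAt ?_)
    refine continuous_sphere_integral (F := fun (r : ℝ) (ζ : S d) =>
      f (r • (ζ : E d)) * evalAt (ζ : E d) q) ?_
    exact (f.continuous.comp (by fun_prop)).mul
      ((continuous_evalAt_sphere q).comp continuous_snd)

/-- The profile as a radial function on `ℝ^p`. -/
def radialLift (p m : ℕ) (q : MvPolynomial (Fin d) ℂ) (f : E d → ℂ) (y : E p) : ℂ :=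
  profile m q f ‖y‖

theorem continuous_radialLift (hd : 2 ≤ d) {m : ℕ} {q : MvPolynomial (Fin d) ℂ}
    (hq : q ∈ harmonicPoly d m) (f : 𝓢(E d, ℂ)) (p : ℕ) :
    Continuous (radialLift p m q f) :=
  (continuousOn_profile hd hq f).comp_continuous continuous_norm fun y => norm_nonneg y

theorem rapidDecay_radialLift (hd : 2 ≤ d) {m : ℕ} {q : MvPolynomial (Fin d) ℂ}
    (hq : q ∈ harmonicPoly d m) (f : 𝓢(E d, ℂ)) (p : ℕ) : RapidDecay (radialLift p m q f) := by
  have hqh := ((mem_harmonicPoly q).1 hq).1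
  intro N
  obtain ⟨A, hA⟩ := (isCompact_Icc (a := (0 : ℝ)) (b := 1)).exists_bound_of_continuousOn
    ((continuousOn_profile hd hq f).mono Set.Icc_subset_Ici_self)
  obtain ⟨D, hD0, hD⟩ := f.decay N 0
  simp only [norm_iteratedFDeriv_zero] at hD
  obtain ⟨B, hB0, hB⟩ := exists_bound_evalAt_sphere q
  refine ⟨|A| + D * B, fun y => ?_⟩
  rw [radialLift]
  have hy := norm_nonneg y
  generalize ‖y‖ = r at hy
  rcases le_total r 1 with h | h
  · have h1 := (hA r ⟨hy, h⟩).trans (le_abs_self A)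
    calc r ^ N * ‖profile m q f r‖ ≤ 1 * |A| := by
          gcongr
          exact pow_le_one₀ hy h
      _ ≤ |A| + D * B := by have := mul_nonneg hD0.le hB0; linarith
  · have hr : 0 < r := by linarith
    rw [profile_of_ne_zero hqh _ hr.ne', norm_mul, norm_inv, norm_pow, Complex.norm_real,
      Real.norm_of_nonneg hy]
    have h2 : (r ^ m)⁻¹ ≤ 1 := inv_le_one_of_one_le₀ (one_le_pow₀ h)
    have h3 : ‖∫ ζ : S d, f (r • (ζ : E d)) * evalAt (ζ : E d) q ∂sphereMeasure d‖ ≤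
        D / r ^ N * B := by
      refine norm_sphere_integral_le hd fun ζ => ?_
      rw [norm_mul]
      have h4 := hD (r • (ζ : E d))
      rw [norm_smul, norm_eq_of_mem_sphere, mul_one, Real.norm_of_nonneg hy] at h4
      gcongr
      · rw [le_div_iff₀ (by positivity), mul_comm]; exact h4
      · exact hB ζ
    calc _ ≤ r ^ N * (1 * (D / r ^ N * B)) := by gcongr
      _ = D * B := by field_simp
      _ ≤ _ := by have := abs_nonneg A; linarith

theorem integrable_radialLift (hd : 2 ≤ d) {m : ℕ} {q : MvPolynomial (Fin d) ℂ}
    (hq : q ∈ harmonicPoly d m) (f : 𝓢(E d, ℂ)) (p : ℕ) : Integrable (radialLift p m q f) :=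
  (rapidDecay_radialLift hd hq f p).integrable
    (continuous_radialLift hd hq f p).aestronglyMeasurable

/-- In polar coordinates, Gaussian integrals of the lift to dimension `d + 2m` are Gaussian
integrals of `q f` in dimension `d`. -/
theorem integral_radialLift_gaussian (hd : 2 ≤ d) {m : ℕ} {q : MvPolynomial (Fin d) ℂ}
    (hq : q ∈ harmonicPoly d m) (f : 𝓢(E d, ℂ)) {b : ℝ} (hb : 0 < b) :
    ∫ y, radialLift (d + 2 * m) m q f y * gaussian (d + 2 * m) b y =
      sphereArea (d + 2 * m) / sphereArea d * ∫ x, f x * polyMul q (gaussian d b) x := by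
  have hqh := ((mem_harmonicPoly q).1 hq).1
  have hbd : ∃ C, ∀ y, ‖radialLift (d + 2 * m) m q f y‖ ≤ C := by
    simpa using rapidDecay_radialLift hd hq f (d + 2 * m) 0
  obtain ⟨A, hA⟩ := hbd
  have hi1 : Integrable fun y => radialLift (d + 2 * m) m q f y * gaussian (d + 2 * m) b y :=
    (gaussian _ b).integrable.bdd_mul (continuous_radialLift hd hq f _).aestronglyMeasurable
      (ae_of_all _ hA)
  have hi2 : Integrable fun x => f x * polyMul q (gaussian d b) x :=
    (polyMul q (gaussian d b)).integrable.bdd_mul f.continuous.aestronglyMeasurable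
      (ae_of_all _ fun x => f.norm_le_seminorm ℝ x)
  have ha : (sphereArea d : ℂ) ≠ 0 := by exact_mod_cast (sphereArea_pos hd).ne'
  rw [integral_polar (by omega) hi1, integral_polar hd hi2, ← mul_assoc, div_mul_cancel₀ _ ha]
  congr 1
  refine setIntegral_congr_fun measurableSet_Ioi fun r hr => ?_
  have hr0 : 0 < r := hr
  have h3 : ∀ {p : ℕ} (ζ : S p), ‖r • (ζ : E p)‖ = r := fun ζ => by
    rw [norm_smul, norm_eq_of_mem_sphere, mul_one, Real.norm_of_nonneg hr0.le]
  simp only [radialLift, gaussian_apply hb, h3, polyMul_apply, evalAt_smul hqh]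
  rw [integral_sphere_const (by omega), profile_of_ne_zero hqh _ hr0.ne']
  have h4 : ∀ ζ : S d, f (r • (ζ : E d)) * ((r : ℂ) ^ m * evalAt (ζ : E d) q *
      Complex.exp (-b * r ^ 2)) = (r : ℂ) ^ m * Complex.exp (-b * r ^ 2) *
        (f (r • (ζ : E d)) * evalAt (ζ : E d) q) := fun ζ => by ring
  simp only [h4]
  rw [integral_const_mul]
  have hrc : (r : ℂ) ≠ 0 := by exact_mod_cast hr0.ne'
  have h5 : d + 2 * m - 1 = (d - 1) + m + m := by omega
  rw [h5, pow_add, pow_add]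
  field_simp

theorem exists_isometry_apply_eq {p : ℕ} {x y : E p} (h : ‖x‖ = ‖y‖) :
    ∃ A : E p ≃ₗᵢ[ℝ] E p, A x = y :=
  ⟨_, Submodule.reflection_sub h⟩

theorem fourier_of_isRadial {p : ℕ} {u : E p → ℂ} (hu : IsRadial u) : IsRadial (𝓕 u) := by
  intro x y hxy
  obtain ⟨A, hA⟩ := exists_isometry_apply_eq hxy
  have h : u ∘ A = u := funext fun z => hu _ _ (A.norm_map z)
  rw [← hA, ← Real.fourier_comp_linearIsometry, h]

/-- A bounded continuous radial function is determined by its integrals against Gaussians. -/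
theorem IsRadial.eq_zero_of_gaussian {p : ℕ} (hp : 2 ≤ p) {u : E p → ℂ} (hu : IsRadial u)
    (hc : Continuous u) {A : ℝ} (hA : ∀ x, ‖u x‖ ≤ A)
    (h : ∀ b : ℝ, 0 < b → ∫ x, u x * gaussian p b x = 0) : u = 0 := by
  have : Nonempty (Fin p) := ⟨⟨0, by omega⟩⟩
  refine Continuous.ext_on (dense_compl_singleton (0 : E p)) hc continuous_const fun x hx => ?_
  have hx0 : 0 < ‖x‖ := norm_pos_iff.2 hx
  have h1 := sphere_integral_eq_zero hp hc hA h hx0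
  have h2 : ∀ ζ : S p, u (‖x‖ • (ζ : E p)) = u x := fun ζ =>
    hu _ _ (by rw [norm_smul, norm_eq_of_mem_sphere, mul_one, norm_norm])
  simp only [h2] at h1
  rwa [integral_sphere_const hp] at h1

/-- The Bochner–Hecke relation: in dimension `d + 2m` the Fourier transform of the profile of `f`
is `i ^ m` times the profile of the Fourier transform of `f`. Both sides have the same integrals
against Gaussians, by Hecke's formula for `q` times a Gaussian in dimension `d`. -/
theorem fourier_radialLift (hd : 2 ≤ d) {m : ℕ} {q : MvPolynomial (Fin d) ℂ}
    (hq : q ∈ harmonicPoly d m) (f : 𝓢(E d, ℂ)) :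
    𝓕 (radialLift (d + 2 * m) m q f) =
      fun y => Complex.I ^ m * radialLift (d + 2 * m) m q (𝓕 f : 𝓢(E d, ℂ)) y := by
  set p := d + 2 * m with hp
  have hi := integrable_radialLift hd hq f p
  have hi' := integrable_radialLift hd hq (𝓕 f) p
  have hFc : Continuous (𝓕 (radialLift p m q f)) :=
    VectorFourier.fourierIntegral_continuous Real.continuous_fourierChar
      (L := innerₗ (E p)) (by exact continuous_inner) hi
  obtain ⟨A, hA⟩ : ∃ A, ∀ y, ‖radialLift p m q (𝓕 f : 𝓢(E d, ℂ)) y‖ ≤ A := by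
    simpa using rapidDecay_radialLift hd hq (𝓕 f) p 0
  have hFb : ∀ y, ‖𝓕 (radialLift p m q f) y‖ ≤ ∫ z, ‖radialLift p m q f z‖ := fun y =>
    VectorFourier.norm_fourierIntegral_le_integral_norm _ _ _ _ _
  have hrad : ∀ f : E d → ℂ, IsRadial (radialLift p m q f) := fun f x y hxy => by
    rw [radialLift, radialLift, hxy]
  have hLc := continuous_radialLift hd hq (𝓕 f) p
  suffices h : (fun y => 𝓕 (radialLift p m q f) y -
      Complex.I ^ m * radialLift p m q (𝓕 f : 𝓢(E d, ℂ)) y) = 0 by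
    ext y
    exact sub_eq_zero.1 (congrFun h y)
  refine IsRadial.eq_zero_of_gaussian (by omega) (fun x y hxy => ?_) (by fun_prop)
    (A := (∫ z, ‖radialLift p m q f z‖) + A) (fun y => ?_) fun b hb => ?_
  · simp only [fourier_of_isRadial (hrad f) x y hxy, hrad _ x y hxy]
  · refine (norm_sub_le _ _).trans (add_le_add (hFb y) ?_)
    rw [norm_mul, norm_pow, Complex.norm_I, one_pow, one_mul]
    exact hA y
  have hb' : 0 < Real.pi ^ 2 / b := by positivity
  have hbc : (b : ℂ) ≠ 0 := by exact_mod_cast hb.ne'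
  have hπ : (Real.pi : ℂ) ≠ 0 := by exact_mod_cast Real.pi_ne_zero
  have h1 : ∫ y, 𝓕 (radialLift p m q f) y * gaussian p b y =
      ∫ y, radialLift p m q f y * 𝓕 (gaussian p b) y := by
    have := VectorFourier.integral_fourierIntegral_smul_eq_flip (μ := volume) (ν := volume)
      (L := innerₗ (E p)) (e := Real.fourierChar) Real.continuous_fourierChar
      (by exact continuous_inner) hi (gaussian p b).integrable
    rw [flip_innerₗ] at this
    exact this
  have h2 : ∫ x, 𝓕 f x * polyMul q (gaussian d b) x =
      ∫ x, f x * 𝓕 (polyMul q (gaussian d b)) x := integral_fourier_mul_eq _ _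
  have h3 : (Real.pi / b : ℂ) ^ (p / 2 : ℂ) = (Real.pi / b : ℂ) ^ (d / 2 : ℂ) *
      (Real.pi / b : ℂ) ^ m := by
    have : (p / 2 : ℂ) = d / 2 + m := by rw [hp]; push_cast; ring
    rw [this, Complex.cpow_add _ _ (div_ne_zero hπ hbc), Complex.cpow_natCast]
  have hm1 : Integrable fun y => 𝓕 (radialLift p m q f) y * gaussian p b y :=
    (gaussian p b).integrable.bdd_mul hFc.aestronglyMeasurable (ae_of_all _ hFb)
  have hm2 : Integrable fun y => radialLift p m q (𝓕 f : 𝓢(E d, ℂ)) y * gaussian p b y :=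
    (gaussian p b).integrable.bdd_mul hLc.aestronglyMeasurable (ae_of_all _ hA)
  simp only [sub_mul, mul_assoc]
  rw [integral_sub hm1 (hm2.const_mul _), integral_const_mul, h1,
    integral_radialLift_gaussian hd hq _ hb, h2, fourier_gaussian hb,
    fourier_polyMul_gaussian hb m q hq, h3]
  simp only [smul_apply, smul_eq_mul]
  have h4 := integral_radialLift_gaussian hd hq f hb'
  simp only [mul_left_comm _ (_ * _ : ℂ), integral_const_mul]
  rw [← hp] at h4
  rw [h4]
  have h5 : Complex.I ^ m * (-Complex.I * Real.pi / b) ^ m = (Real.pi / b : ℂ) ^ m := by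
    rw [← mul_pow]
    congr 1
    have : Complex.I * (-Complex.I * Real.pi / b) = -(Complex.I * Complex.I) * (Real.pi / b) := by
      ring
    rw [this, Complex.I_mul_I]
    ring
  rw [← h5]
  ring

/-- The profile of a Schwartz function is the profile of a radial Schwartz function in dimension
`d + 2m`, whose Fourier transform is `i ^ m` times the profile of the Fourier transform. -/
theorem exists_schwartz_radialLift (hd : 2 ≤ d) {m : ℕ} {q : MvPolynomial (Fin d) ℂ}
    (hq : q ∈ harmonicPoly d m) (f : 𝓢(E d, ℂ)) :
    ∃ g : 𝓢(E (d + 2 * m), ℂ), ⇑g = radialLift (d + 2 * m) m q f ∧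
      ⇑(𝓕 g : 𝓢(E (d + 2 * m), ℂ)) =
        fun y => Complex.I ^ m * radialLift (d + 2 * m) m q (𝓕 f : 𝓢(E d, ℂ)) y := by
  have hI : Complex.I ^ m ≠ 0 := pow_ne_zero _ Complex.I_ne_zero
  -- the lift of `f` is a multiple of the Fourier transform of the lift of `𝓕⁻ f`
  have h1 := fourier_radialLift hd hq (𝓕⁻ f)
  rw [FourierTransform.fourier_fourierInv_eq] at h1
  have hdec : RapidDecay fun y => Complex.I ^ m * radialLift (d + 2 * m) m q f y := fun N => by
    obtain ⟨K, hK⟩ := rapidDecay_radialLift hd hq f (d + 2 * m) N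
    refine ⟨K, fun y => ?_⟩
    rw [norm_mul, norm_pow, Complex.norm_I, one_pow, one_mul]
    exact hK y
  obtain ⟨g, hg⟩ := exists_schwartz_of_fourier hdec
    (rapidDecay_radialLift hd hq (𝓕⁻ f) (d + 2 * m))
    (continuous_radialLift hd hq (𝓕⁻ f) _).aestronglyMeasurable h1.symm
  have hg' : ⇑((Complex.I ^ m)⁻¹ • g) = radialLift (d + 2 * m) m q f := by
    ext y
    rw [smul_apply, hg, smul_eq_mul, inv_mul_cancel_left₀ hI]
  refine ⟨(Complex.I ^ m)⁻¹ • g, hg', ?_⟩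
  rw [fourier_coe, hg', fourier_radialLift hd hq f]

/-! ### Angular derivatives and decay of spherical harmonic components -/

/-- The angular derivative `x_i ∂_j - x_j ∂_i` on Schwartz functions. -/
def angular (i j : Fin d) (f : 𝓢(E d, ℂ)) : 𝓢(E d, ℂ) :=
  polyMul (X i) (∂_{stdVec j} f) - polyMul (X j) (∂_{stdVec i} f)

/-- The angular derivative `x_i ∂_j - x_j ∂_i` on polynomials. -/
def angularPoly (i j : Fin d) (P : MvPolynomial (Fin d) ℂ) : MvPolynomial (Fin d) ℂ :=
  X i * pderiv j P - X j * pderiv i P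

theorem pderiv_X_comm (i j : Fin d) :
    pderiv j (X i : MvPolynomial (Fin d) ℂ) = pderiv i (X j) := by
  by_cases h : i = j
  · rw [h]
  · rw [MvPolynomial.pderiv_X_of_ne h, MvPolynomial.pderiv_X_of_ne (Ne.symm h)]

/-- Angular derivatives are skew-symmetric for every radial weight. -/
theorem integral_angular_mul_gaussian (i j : Fin d) (f : 𝓢(E d, ℂ)) (P : MvPolynomial (Fin d) ℂ)
    {b : ℝ} (hb : 0 < b) :
    ∫ x, angular i j f x * polyMul P (gaussian d b) x =
      -∫ x, f x * polyMul (angularPoly i j P) (gaussian d b) x := by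
  set u := polyMul P (gaussian d b) with hu
  have h1 : ∀ k l : Fin d, ∫ x, f x * (∂_{stdVec l} (polyMul (X k) u)) x =
      -∫ x, (∂_{stdVec l} f) x * polyMul (X k) u x := fun k l =>
    integral_mul_lineDerivOp_right_eq_neg_left f (polyMul (X k) u) (stdVec l)
  have hmi : ∀ g h : 𝓢(E d, ℂ), Integrable fun x => g x * h x := fun g h =>
    h.integrable.bdd_mul g.continuous.aestronglyMeasurable
      (ae_of_all _ fun x => g.norm_le_seminorm ℝ x)
  have h2 : ∫ x, angular i j f x * u x =
      (∫ x, (∂_{stdVec j} f) x * polyMul (X i) u x) -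
        ∫ x, (∂_{stdVec i} f) x * polyMul (X j) u x := by
    rw [← integral_sub (hmi _ _) (hmi _ _)]
    congr 1; ext x
    simp only [angular, sub_apply, polyMul_apply]
    ring
  have h3 : ∫ x, f x * polyMul (angularPoly i j P) (gaussian d b) x =
      (∫ x, f x * (∂_{stdVec j} (polyMul (X i) u)) x) -
        ∫ x, f x * (∂_{stdVec i} (polyMul (X j) u)) x := by
    rw [← integral_sub (hmi _ _) (hmi _ _)]
    congr 1; ext x
    simp only [hu, lineDeriv_polyMul, add_apply, polyMul_apply, lineDeriv_gaussian_apply hb,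
      angularPoly, map_sub, evalAt_mul, evalAt_X, pderiv_X_comm i j]
    ring
  rw [h2, h3, h1, h1]
  ring

/-- The sum of the squares of the angular derivatives acts on harmonic polynomials of degree `m`
as multiplication by `-2 m (m + d - 2)`; every unordered pair of indices is counted twice. -/
theorem sum_angularPoly_angularPoly {m : ℕ} {q : MvPolynomial (Fin d) ℂ}
    (hq : q ∈ harmonicPoly d m) :
    ∑ i, ∑ j, angularPoly i j (angularPoly i j q) =
      C (-(2 * m * (m + d - 2)) : ℂ) * q := by
  rw [mem_harmonicPoly] at hq
  have hE : ∑ i, X i * pderiv i q = C (m : ℂ) * q := by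
    rw [hq.1.sum_X_mul_pderiv, nsmul_eq_mul]; simp
  have hE2 : ∀ i, ∑ j, X j * pderiv j (pderiv i q) = C (m - 1 : ℂ) * pderiv i q := fun i => by
    have h1 := congrArg (pderiv i) hE
    simp only [map_sum, Derivation.leibniz, smul_eq_mul, Finset.sum_add_distrib,
      MvPolynomial.pderiv_C, mul_zero, add_zero, MvPolynomial.pderiv_X, Pi.single_apply,
      mul_ite, mul_one, mul_zero, Finset.sum_ite_eq', Finset.mem_univ,
      if_true] at h1
    simp only [pderiv_comm _ i, map_sub, map_one]
    linear_combination h1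
  have hterm : ∀ i j : Fin d, angularPoly i j (angularPoly i j q) =
      2 * (if i = j then X i * pderiv i q else 0) +
      (X i ^ 2 * pderiv j (pderiv j q) + X j ^ 2 * pderiv i (pderiv i q)) -
      (X i * pderiv i q + X j * pderiv j q) -
      2 * (X i * (X j * pderiv j (pderiv i q))) := fun i j => by
    by_cases h : i = j
    · subst h
      simp only [angularPoly, sub_self, if_true, mul_zero, map_zero]
      ring
    · simp only [angularPoly, map_sub, Derivation.leibniz, smul_eq_mul, MvPolynomial.pderiv_X_self,
        MvPolynomial.pderiv_X_of_ne h, MvPolynomial.pderiv_X_of_ne (Ne.symm h), if_neg h,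
        pderiv_comm i j q]
      ring
  have h5 : ∑ i, X i * (C (m - 1 : ℂ) * pderiv i q) = C (m - 1 : ℂ) * (C (m : ℂ) * q) := by
    rw [← hE, Finset.mul_sum]
    exact Finset.sum_congr rfl fun i _ => by ring
  have h6 : ∑ i, ∑ j, X i ^ 2 * pderiv j (pderiv j q) = 0 := by
    simp only [← Finset.mul_sum, hq.2, mul_zero, Finset.sum_const_zero]
  have h7 : ∑ i, ∑ j, X j ^ 2 * pderiv i (pderiv i q) = 0 := by rw [Finset.sum_comm, h6]
  have h8 : ∑ i, ∑ _j : Fin d, X i * pderiv i q = C (d : ℂ) * (C (m : ℂ) * q) := by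
    simp only [Finset.sum_const, Finset.card_univ, Fintype.card_fin, nsmul_eq_mul, ← Finset.mul_sum,
      hE, map_natCast]
  have h9 : ∑ _i : Fin d, ∑ j, X j * pderiv j q = C (d : ℂ) * (C (m : ℂ) * q) := by
    simp only [Finset.sum_const, Finset.card_univ, Fintype.card_fin, hE, nsmul_eq_mul, map_natCast]
  have h10 : ∑ i, ∑ j, 2 * (if i = j then X i * pderiv i q else 0) = 2 * (C (m : ℂ) * q) := by
    simp only [← Finset.mul_sum, Finset.sum_ite_eq, Finset.mem_univ, if_true, hE]
  have h11 : ∑ i, ∑ j, 2 * (X i * (X j * pderiv j (pderiv i q))) =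
      2 * (C (m - 1 : ℂ) * (C (m : ℂ) * q)) := by
    simp only [← Finset.mul_sum, hE2, h5]
  rw [Finset.sum_congr rfl fun i _ => Finset.sum_congr rfl fun j _ => hterm i j]
  simp only [Finset.sum_sub_distrib, Finset.sum_add_distrib]
  rw [h6, h7, h8, h9, h10, h11]
  simp only [map_neg, map_mul, map_sub, map_add, map_natCast, map_ofNat, map_one]
  ring

/-- The sum of the squares of the angular derivatives: on the sphere of radius
`r` around the origin it is `2 r²` times the Laplace–Beltrami operator. -/
def angularLaplacian (f : 𝓢(E d, ℂ)) : 𝓢(E d, ℂ) := ∑ i, ∑ j, angular i j (angular i j f)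

/-- The angular Laplacian is symmetric on spheres, and harmonic polynomials are its eigenfunctions.
The identity is obtained by testing against Gaussians, where symmetry is integration by parts on
the whole space. -/
theorem sphere_integral_angularLaplacian (hd : 2 ≤ d) {m : ℕ} {q : MvPolynomial (Fin d) ℂ}
    (hq : q ∈ harmonicPoly d m) (f : 𝓢(E d, ℂ)) {r : ℝ} (hr : 0 < r) :
    ∫ ζ : S d, angularLaplacian f (r • (ζ : E d)) * evalAt (ζ : E d) q ∂sphereMeasure d =
      -(2 * m * (m + d - 2)) *
        ∫ ζ : S d, f (r • (ζ : E d)) * evalAt (ζ : E d) q ∂sphereMeasure d := by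
  have hqh := ((mem_harmonicPoly q).1 hq).1
  set c : ℂ := -(2 * m * (m + d - 2)) with hc
  set F : 𝓢(E d, ℂ) := polyMul q (angularLaplacian f) - c • polyMul q f with hF
  have hmi : ∀ g h : 𝓢(E d, ℂ), Integrable fun x => g x * h x := fun g h =>
    h.integrable.bdd_mul g.continuous.aestronglyMeasurable
      (ae_of_all _ fun x => g.norm_le_seminorm ℝ x)
  have h1 : ∀ b : ℝ, 0 < b → ∫ x, F x * gaussian d b x = 0 := fun b hb => by
    have h2 : ∫ x, angularLaplacian f x * polyMul q (gaussian d b) x =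
        c * ∫ x, f x * polyMul q (gaussian d b) x := by
      simp only [angularLaplacian, sum_apply, Finset.sum_mul]
      rw [integral_finsetSum _ fun i _ => integrable_finsetSum _ fun j _ => hmi _ _]
      simp only [integral_finsetSum _ fun j _ => hmi _ _]
      simp only [integral_angular_mul_gaussian _ _ _ _ hb, neg_neg]
      have h3 : ∀ x, f x * polyMul (∑ i, ∑ j, angularPoly i j (angularPoly i j q))
          (gaussian d b) x = ∑ i, ∑ j, f x *
            polyMul (angularPoly i j (angularPoly i j q)) (gaussian d b) x := fun x => by
        simp only [polyMul_apply, map_sum, Finset.mul_sum, Finset.sum_mul]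
      rw [← integral_const_mul]
      have h4 : ∀ x, c * (f x * polyMul q (gaussian d b) x) =
          f x * polyMul (C c * q) (gaussian d b) x := fun x => by
        simp only [polyMul_apply, evalAt_mul, evalAt_C]; ring
      simp only [h4]
      rw [← sum_angularPoly_angularPoly hq]
      simp only [h3]
      rw [integral_finsetSum _ fun i _ => integrable_finsetSum _ fun j _ => hmi _ _]
      simp only [integral_finsetSum _ fun j _ => hmi _ _]
    have h5 : ∀ x, F x * gaussian d b x = angularLaplacian f x * polyMul q (gaussian d b) x -
        c * (f x * polyMul q (gaussian d b) x) := fun x => by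
      simp only [hF, sub_apply, smul_apply, polyMul_apply, smul_eq_mul]; ring
    simp only [h5]
    rw [integral_sub (hmi _ _) ((hmi _ _).const_mul _), integral_const_mul, h2, sub_self]
  have h6 := sphere_integral_eq_zero hd F.continuous (fun x => F.norm_le_seminorm ℝ x) h1 hr
  have h7 : ∀ ζ : S d, F (r • (ζ : E d)) = (r : ℂ) ^ m *
      (angularLaplacian f (r • (ζ : E d)) * evalAt (ζ : E d) q -
        c * (f (r • (ζ : E d)) * evalAt (ζ : E d) q)) := fun ζ => by
    simp only [hF, sub_apply, smul_apply, polyMul_apply, smul_eq_mul, evalAt_smul hqh]; ring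
  have hci : ∀ g : 𝓢(E d, ℂ), Integrable
      (fun ζ : S d => g (r • (ζ : E d)) * evalAt (ζ : E d) q) (sphereMeasure d) := fun g =>
    integrable_sphere ((g.continuous.comp (by fun_prop)).mul (continuous_evalAt_sphere _))
  simp only [h7] at h6
  rw [integral_const_mul, integral_sub (hci _) ((hci _).const_mul _), integral_const_mul,
    mul_eq_zero, or_iff_right (pow_ne_zero _ (by exact_mod_cast hr.ne')), sub_eq_zero] at h6
  exact h6

/-- Spherical harmonic coefficients of a Schwartz function decay faster than any power of the
degree. -/
theorem exists_bound_sphere_integral (hd : 2 ≤ d) (f : 𝓢(E d, ℂ)) {r : ℝ} (hr : 0 < r) (N : ℕ) :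
    ∃ K : ℝ, 0 ≤ K ∧ ∀ (m : ℕ), ∀ q ∈ harmonicPoly d m,
      (m : ℝ) ^ (2 * N) *
        ‖∫ ζ : S d, f (r • (ζ : E d)) * evalAt (ζ : E d) q ∂sphereMeasure d‖ ≤
      K * ∫ ζ : S d, ‖evalAt (ζ : E d) q‖ ∂sphereMeasure d := by
  set g := angularLaplacian^[N] f with hg
  refine ⟨SchwartzMap.seminorm ℝ 0 0 g, apply_nonneg _ _, fun m q hq => ?_⟩
  have h1 : ∀ n : ℕ, ∫ ζ : S d, angularLaplacian^[n] f (r • (ζ : E d)) * evalAt (ζ : E d) q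
      ∂sphereMeasure d = (-(2 * m * (m + d - 2)) : ℂ) ^ n *
        ∫ ζ : S d, f (r • (ζ : E d)) * evalAt (ζ : E d) q ∂sphereMeasure d := fun n => by
    induction n with
    | zero => simp
    | succ n ih =>
      rw [Function.iterate_succ_apply', sphere_integral_angularLaplacian hd hq _ hr, ih, pow_succ']
      ring
  have h2 : (m : ℝ) ^ 2 ≤ ‖(-(2 * m * (m + d - 2)) : ℂ)‖ := by
    have h3 : (-(2 * m * (m + d - 2)) : ℂ) = ((-(2 * m * (m + d - 2)) : ℝ) : ℂ) := by
      push_cast; ring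
    have hd' : (2 : ℝ) ≤ d := by exact_mod_cast hd
    have hm : (0 : ℝ) ≤ m := m.cast_nonneg
    rw [h3, Complex.norm_real, norm_neg, Real.norm_of_nonneg
      (mul_nonneg (by positivity) (by linarith))]
    nlinarith [mul_nonneg hm (sub_nonneg.2 hd')]
  calc (m : ℝ) ^ (2 * N) *
        ‖∫ ζ : S d, f (r • (ζ : E d)) * evalAt (ζ : E d) q ∂sphereMeasure d‖
      ≤ ‖(-(2 * m * (m + d - 2)) : ℂ)‖ ^ N *
        ‖∫ ζ : S d, f (r • (ζ : E d)) * evalAt (ζ : E d) q ∂sphereMeasure d‖ := by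
        rw [pow_mul]; gcongr
    _ = ‖∫ ζ : S d, g (r • (ζ : E d)) * evalAt (ζ : E d) q ∂sphereMeasure d‖ := by
        rw [hg, h1 N, norm_mul, norm_pow]
    _ ≤ _ := by
        rw [← integral_const_mul]
        refine norm_integral_le_of_norm_le ?_ (ae_of_all _ fun ζ => ?_)
        · exact ((integrable_sphere (continuous_evalAt_sphere q)).norm).const_mul _
        · rw [norm_mul]
          gcongr
          exact g.norm_le_seminorm ℝ _

/-! ### Zonal harmonics: symmetry, rotation invariance and size -/

theorem eq_rieszVector {V : Type} [AddCommGroup V] [Module ℂ V] [FiniteDimensional ℂ V]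
    (cd : InnerProductSpace.Core ℂ V) (φ : V →ₗ[ℂ] ℂ) (w : V) (h : ∀ v, cd.inner w v = φ v) :
    w = rieszVector cd φ := by
  let i1 := cd.toNormedAddCommGroup
  let i2 := InnerProductSpace.ofCore cd.toCore
  refine ext_inner_right ℂ fun v => ?_
  exact (h v).trans (rieszVector_spec cd φ v).symm

/-- A finite-dimensional inner product space has an orthonormal basis, stated for an inner product
that is not an instance. -/
theorem exists_orthonormal_family {V : Type} [AddCommGroup V] [Module ℂ V] [FiniteDimensional ℂ V]
    (cd : InnerProductSpace.Core ℂ V) :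
    ∃ e : Fin (Module.finrank ℂ V) → V, (∀ i, cd.inner (e i) (e i) = 1) ∧
      ∀ v, v = ∑ i, cd.inner (e i) v • e i := by
  let i1 := cd.toNormedAddCommGroup
  let i2 := InnerProductSpace.ofCore cd.toCore
  let e := stdOrthonormalBasis ℂ V
  refine ⟨e, fun i => ?_, fun v => (e.sum_repr' v).symm⟩
  have h1 := inner_self_eq_norm_sq_to_K (𝕜 := ℂ) (e i)
  rw [e.orthonormal.1 i, RCLike.ofReal_one, one_pow] at h1
  exact h1

theorem harmonicCore_inner (hd : 2 ≤ d) (m : ℕ) (u v : harmonicPoly d m) :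
    (harmonicCore hd m).inner u v =
      ∫ ζ : S d, starRingEnd ℂ (evalAt (ζ : E d) u) * evalAt (ζ : E d) v ∂sphereMeasure d := rfl

theorem inner_zonalPoly (hd : 2 ≤ d) (m : ℕ) (η : E d) (v : harmonicPoly d m) :
    (harmonicCore hd m).inner (zonalPoly hd m η) v = evalAt η v :=
  rieszVector_spec (harmonicCore hd m) (evalAt η ∘ₗ (harmonicPoly d m).subtype) v

theorem zonal_conj_symm (hd : 2 ≤ d) (m : ℕ) (x η : E d) :
    zonal hd m x η = starRingEnd ℂ (zonal hd m η x) := by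
  have h1 := inner_zonalPoly hd m x (zonalPoly hd m η)
  have h2 := inner_zonalPoly hd m η (zonalPoly hd m x)
  rw [zonal, ← h1, zonal, ← h2]
  exact ((harmonicCore hd m).conj_inner_symm _ _).symm

/-- As a function of its second variable, the zonal harmonic is a harmonic polynomial. -/
theorem zonal_eq_evalAt (hd : 2 ≤ d) (m : ℕ) (x η : E d) :
    zonal hd m x η = evalAt η (conjPoly (zonalPoly hd m x : MvPolynomial (Fin d) ℂ)) := by
  rw [zonal_conj_symm, zonal, evalAt_conjPoly]

/-- The polynomial `x ↦ P (A x)`, for an orthogonal map `A`. -/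
def rotPoly (A : E d ≃ₗᵢ[ℝ] E d) (P : MvPolynomial (Fin d) ℂ) : MvPolynomial (Fin d) ℂ :=
  MvPolynomial.aeval (fun i => ∑ j, C ((A (stdVec j) i : ℝ) : ℂ) * X j) P

theorem apply_eq_sum_stdVec (A : E d ≃ₗᵢ[ℝ] E d) (x : E d) (i : Fin d) :
    A x i = ∑ j, A (stdVec j) i * x j := by
  have h1 : x = ∑ j, x j • (stdVec j : E d) := by
    ext k
    simp [stdVec, Pi.single_apply]
  conv_lhs => rw [h1]
  simp only [map_sum, map_smul]
  simp [mul_comm]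

theorem evalAt_rotPoly (A : E d ≃ₗᵢ[ℝ] E d) (x : E d) (P : MvPolynomial (Fin d) ℂ) :
    evalAt x (rotPoly A P) = evalAt (A x) P := by
  induction P using MvPolynomial.induction_on with
  | C a => simp [rotPoly, evalAt_apply]
  | add P Q hP hQ =>
    simp only [rotPoly] at hP hQ ⊢
    simp only [map_add, hP, hQ]
  | mul_X P i hP =>
    simp only [rotPoly] at hP ⊢
    rw [map_mul, evalAt_mul, hP, evalAt_mul, evalAt_X, apply_eq_sum_stdVec A x i]
    simp [evalAt_mul, evalAt_C, evalAt_X]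

theorem pderiv_rotPoly (A : E d ≃ₗᵢ[ℝ] E d) (P : MvPolynomial (Fin d) ℂ) (k : Fin d) :
    pderiv k (rotPoly A P) =
      ∑ i, C ((A (stdVec k) i : ℝ) : ℂ) * rotPoly A (pderiv i P) := by
  induction P using MvPolynomial.induction_on with
  | C a => simp [rotPoly]
  | add P Q hP hQ =>
    simp only [rotPoly] at hP hQ ⊢
    simp only [map_add, hP, hQ, mul_add, Finset.sum_add_distrib]
  | mul_X P j hP =>
    have h1 : rotPoly A (P * X j) =
        rotPoly A P * ∑ l, C ((A (stdVec l) j : ℝ) : ℂ) * X l := by simp [rotPoly]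
    have h2 : pderiv k (∑ l, C ((A (stdVec l) j : ℝ) : ℂ) * X l) =
        C ((A (stdVec k) j : ℝ) : ℂ) := by
      simp [MvPolynomial.pderiv_X, Pi.single_apply]
    have h3 : ∀ i, rotPoly A (pderiv i (P * X j)) = (if j = i then rotPoly A P else 0) +
        (∑ l, C ((A (stdVec l) j : ℝ) : ℂ) * X l) * rotPoly A (pderiv i P) := fun i => by
      by_cases h : j = i
      · subst h
        simp [rotPoly]
      · simp [rotPoly, MvPolynomial.pderiv_X_of_ne h, h]
    rw [h1, Derivation.leibniz, h2, hP]
    simp only [h3, mul_add, Finset.sum_add_distrib, smul_eq_mul, mul_ite, mul_zero,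
      Finset.sum_ite_eq, Finset.mem_univ, if_true]
    rw [Finset.mul_sum, mul_comm]
    congr 1
    exact Finset.sum_congr rfl fun i _ => by ring

/-- The rows of an orthogonal matrix are orthonormal. -/
theorem sum_stdVec_mul (A : E d ≃ₗᵢ[ℝ] E d) (i l : Fin d) :
    ∑ k, A (stdVec k) i * A (stdVec k) l = if i = l then 1 else 0 := by
  have h1 : ∀ k i, A (stdVec k) i = A.symm (stdVec i) k := fun k i => by
    rw [← inner_stdVec, ← inner_stdVec, real_inner_comm, ← A.symm.inner_map_map, A.symm_apply_apply]
  simp only [h1]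
  have h2 : inner ℝ (A.symm (stdVec l)) (A.symm (stdVec i)) = inner ℝ (stdVec l) (stdVec i : E d) :=
    A.symm.inner_map_map _ _
  rw [PiLp.inner_apply] at h2
  simp only [RCLike.inner_apply, conj_trivial] at h2
  rw [h2, inner_stdVec]
  simp [stdVec]

theorem rotPoly_mem (A : E d ≃ₗᵢ[ℝ] E d) {m : ℕ} {q : MvPolynomial (Fin d) ℂ}
    (hq : q ∈ harmonicPoly d m) : rotPoly A q ∈ harmonicPoly d m := by
  rw [mem_harmonicPoly] at hq ⊢
  constructor
  · have h1 := hq.1.aeval (fun i => ∑ j, C ((A (stdVec j) i : ℝ) : ℂ) * X j) (n := 1)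
      (fun i => IsHomogeneous.sum _ _ _ fun j _ => MvPolynomial.isHomogeneous_C_mul_X _ _)
    rwa [one_mul] at h1
  · have h2 : ∀ k, pderiv k (pderiv k (rotPoly A q)) =
        ∑ i, ∑ l, C ((A (stdVec k) i * A (stdVec k) l : ℝ) : ℂ) *
          rotPoly A (pderiv l (pderiv i q)) := fun k => by
      rw [pderiv_rotPoly, map_sum]
      refine Finset.sum_congr rfl fun i _ => ?_
      rw [Derivation.leibniz, MvPolynomial.pderiv_C, smul_zero, add_zero, pderiv_rotPoly,
        smul_eq_mul, Finset.mul_sum]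
      refine Finset.sum_congr rfl fun l _ => ?_
      rw [← mul_assoc, ← map_mul, Complex.ofReal_mul]
    simp only [h2]
    rw [Finset.sum_comm]
    have h3 : ∀ i, ∑ k, ∑ l, C ((A (stdVec k) i * A (stdVec k) l : ℝ) : ℂ) *
        rotPoly A (pderiv l (pderiv i q)) = rotPoly A (pderiv i (pderiv i q)) := fun i => by
      rw [Finset.sum_comm]
      simp only [← Finset.sum_mul, ← map_sum, ← Complex.ofReal_sum, sum_stdVec_mul]
      rw [Finset.sum_eq_single i (fun l _ hl => by simp [hl.symm]) (by simp)]
      simp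
    simp only [h3]
    have h4 := congrArg (rotPoly A) hq.2
    simpa [rotPoly] using h4

/-- Invariance of the spherical mean under orthogonal maps, for homogeneous polynomials; it is read off
from the invariance of the Gaussian integral. -/
theorem sphere_integral_rotPoly (hd : 2 ≤ d) (A : E d ≃ₗᵢ[ℝ] E d) {n : ℕ}
    {P : MvPolynomial (Fin d) ℂ} (hP : P.IsHomogeneous n) :
    ∫ ζ : S d, evalAt (A (ζ : E d)) P ∂sphereMeasure d =
      ∫ ζ : S d, evalAt (ζ : E d) P ∂sphereMeasure d := by
  obtain ⟨γ, hγ, h⟩ := gaussForm_eq_sphere hd n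
  have h1 : (rotPoly A P).IsHomogeneous n := by
    have h1 := hP.aeval (fun i => ∑ j, C ((A (stdVec j) i : ℝ) : ℂ) * X j) (n := 1)
      (fun i => IsHomogeneous.sum _ _ _ fun j _ => MvPolynomial.isHomogeneous_C_mul_X _ _)
    rwa [one_mul] at h1
  have h2 := h _ h1
  simp only [evalAt_rotPoly] at h2
  refine mul_left_cancel₀ hγ ?_
  rw [← h2, ← h P hP, gaussForm_apply, gaussForm_apply,
    ← A.measurePreserving.integral_comp A.toHomeomorph.measurableEmbedding
      fun x => evalAt x P * gaussian d (1 / 2) x]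
  congr 1; ext x
  rw [evalAt_rotPoly, gaussian_apply one_half_pos, gaussian_apply one_half_pos, A.norm_map]

theorem zonalPoly_rot (hd : 2 ≤ d) (m : ℕ) (A : E d ≃ₗᵢ[ℝ] E d) (η : E d) :
    rotPoly A (zonalPoly hd m (A η) : MvPolynomial (Fin d) ℂ) = zonalPoly hd m η := by
  set w : harmonicPoly d m :=
    ⟨rotPoly A (zonalPoly hd m (A η) : MvPolynomial (Fin d) ℂ), rotPoly_mem A (Subtype.mem _)⟩
    with hw
  suffices h : w = zonalPoly hd m η from congrArg Subtype.val h
  refine eq_rieszVector _ _ _ fun v => ?_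
  set v' : harmonicPoly d m := ⟨rotPoly A.symm v, rotPoly_mem A.symm v.2⟩ with hv'
  have h1 := inner_zonalPoly hd m (A η) v'
  rw [harmonicCore_inner] at h1 ⊢
  have h2 := sphere_integral_rotPoly hd A (n := m + m)
    (P := conjPoly (zonalPoly hd m (A η) : MvPolynomial (Fin d) ℂ) * (v' : MvPolynomial (Fin d) ℂ))
    (IsHomogeneous.mul (((mem_harmonicPoly _).1 (zonalPoly hd m (A η)).2).1.map _)
      ((mem_harmonicPoly _).1 v'.2).1)
  simp only [evalAt_mul, evalAt_conjPoly] at h2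
  rw [h1] at h2
  simp only [hv', evalAt_rotPoly, A.symm_apply_apply] at h2
  simp only [hw, evalAt_rotPoly]
  exact h2

theorem finrank_harmonicPoly_le (m : ℕ) : Module.finrank ℂ (harmonicPoly d m) ≤ (m + 1) ^ d := by
  let T : harmonicPoly d m →ₗ[ℂ] ((Fin d → Fin (m + 1)) → ℂ) :=
    LinearMap.pi fun a => (MvPolynomial.lcoeff ℂ (Finsupp.equivFunOnFinite.symm
      fun i => (a i : ℕ))) ∘ₗ (harmonicPoly d m).subtype
  have hT : Function.Injective T := by
    rw [← LinearMap.ker_eq_bot, LinearMap.ker_eq_bot']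
    intro q hq
    refine Subtype.ext (MvPolynomial.ext _ _ fun s => ?_)
    rw [Submodule.coe_zero, MvPolynomial.coeff_zero]
    by_contra hs
    have h1 : ∑ i, s i = m := by
      have := ((mem_harmonicPoly _).1 q.2).1 hs
      simpa [Finsupp.weight_apply, Finsupp.sum_fintype] using this
    have h2 : ∀ i, s i < m + 1 := fun i => by
      have := Finset.single_le_sum (f := fun i => s i) (fun _ _ => Nat.zero_le _) (Finset.mem_univ i)
      simp only [h1] at this
      omega
    have h3 := congrFun hq fun i => ⟨s i, h2 i⟩
    apply hs
    simpa [T] using h3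
  have := LinearMap.finrank_le_finrank_of_injective hT
  simpa using this

/-- On the unit sphere the diagonal of the reproducing kernel is constant, equal to the dimension
of the space of harmonic polynomials. -/
theorem zonal_self (hd : 2 ≤ d) (m : ℕ) (η : S d) :
    zonal hd m η η = Module.finrank ℂ (harmonicPoly d m) := by
  obtain ⟨e, he1, he2⟩ := exists_orthonormal_family (harmonicCore hd m)
  have h1 : ∀ x : E d, zonal hd m x x =
      ∑ i, starRingEnd ℂ (evalAt x (e i : MvPolynomial (Fin d) ℂ)) * evalAt x (e i : MvPolynomial (Fin d) ℂ) := by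
    intro x
    have h2 := congrArg (fun v : harmonicPoly d m => evalAt x (v : MvPolynomial (Fin d) ℂ))
      (he2 (zonalPoly hd m x))
    simp only [Submodule.coe_sum, Submodule.coe_smul, map_sum, map_smul, smul_eq_mul] at h2
    rw [zonal, h2]
    refine Finset.sum_congr rfl fun i _ => ?_
    rw [← inner_zonalPoly hd m x (e i)]
    congr 1
    exact ((harmonicCore hd m).conj_inner_symm _ _).symm
  have h3 : ∀ ζ : S d, zonal hd m ζ ζ = zonal hd m η η := fun ζ => by
    obtain ⟨A, hA⟩ := exists_isometry_apply_eq (x := (ζ : E d)) (y := (η : E d))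
      (by rw [norm_eq_of_mem_sphere, norm_eq_of_mem_sphere])
    rw [zonal, ← zonalPoly_rot hd m A, evalAt_rotPoly, hA, zonal]
  have h4 : ∫ ζ : S d, zonal hd m ζ ζ ∂sphereMeasure d = Module.finrank ℂ (harmonicPoly d m) := by
    simp only [h1]
    rw [integral_finsetSum]
    · have h5 : ∀ i, ∫ ζ : S d, starRingEnd ℂ (evalAt (ζ : E d) (e i : MvPolynomial (Fin d) ℂ)) *
          evalAt (ζ : E d) (e i : MvPolynomial (Fin d) ℂ) ∂sphereMeasure d = 1 := he1
      simp [h5]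
    · exact fun i _ => integrable_sphere ((Complex.continuous_conj.comp
        (continuous_evalAt_sphere _)).mul (continuous_evalAt_sphere _))
  simp only [h3] at h4
  rwa [integral_sphere_const hd] at h4

/-- The reproducing property bounds the `L²` norm of the zonal harmonic by the dimension of the space of
harmonic polynomials. -/
theorem integral_norm_zonalPoly_le (hd : 2 ≤ d) (m : ℕ) (η : S d) :
    ∫ ζ : S d, ‖evalAt (ζ : E d) (zonalPoly hd m η : MvPolynomial (Fin d) ℂ)‖ ∂sphereMeasure d ≤
      2 * (m + 1 : ℝ) ^ d := by
  set F : S d → ℂ := fun ζ => evalAt (ζ : E d) (zonalPoly hd m η : MvPolynomial (Fin d) ℂ) with hF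
  have hc : Continuous F := continuous_evalAt_sphere _
  have h1 : ∫ ζ, ‖F ζ‖ ^ 2 ∂sphereMeasure d = Module.finrank ℂ (harmonicPoly d m) := by
    have h2 := inner_zonalPoly hd m η (zonalPoly hd m η)
    rw [harmonicCore_inner] at h2
    have h3 : ∀ z : ℂ, starRingEnd ℂ z * z = ((‖z‖ ^ 2 : ℝ) : ℂ) := fun z => by
      rw [Complex.conj_mul']; simp
    simp only [h3] at h2
    rw [integral_complex_ofReal] at h2
    have h4 := zonal_self hd m η
    rw [zonal, ← h2] at h4
    exact_mod_cast h4
  have hi : Integrable (fun ζ => ‖F ζ‖ ^ 2) (sphereMeasure d) :=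
    (hc.norm.pow 2).integrable_of_hasCompactSupport (HasCompactSupport.of_compactSpace _)
  have h5 : ∫ ζ, ‖F ζ‖ ∂sphereMeasure d ≤ ∫ ζ, (1 + ‖F ζ‖ ^ 2) ∂sphereMeasure d := by
    refine integral_mono (integrable_sphere hc).norm ((integrable_const 1).add hi) fun ζ => ?_
    simp only []
    nlinarith [sq_nonneg (‖F ζ‖ - 1)]
  rw [integral_add (integrable_const 1) hi, h1, integral_const, measureReal_def,
    sphereMeasure_univ hd] at h5
  have h6 : (Module.finrank ℂ (harmonicPoly d m) : ℝ) ≤ (m + 1 : ℝ) ^ d := by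
    exact_mod_cast finrank_harmonicPoly_le m
  have h7 : (1 : ℝ) ≤ (m + 1 : ℝ) ^ d := one_le_pow₀ (by
    have : (0 : ℝ) ≤ m := m.cast_nonneg
    linarith)
  simp only [ENNReal.toReal_one, smul_eq_mul, mul_one] at h5
  linarith

/-! ### The expansion of a Schwartz function in spherical harmonics -/

/-- The orthogonal projection of a continuous function on the sphere to `𝓗_m(ℝ^d)`. -/
def harmonicProj (hd : 2 ≤ d) (m : ℕ) (φ : C(S d, ℂ)) : harmonicPoly d m :=
  rieszVector (harmonicCore hd m)
    { toFun := fun u => ∫ ζ : S d, starRingEnd ℂ (φ ζ) * evalAt (ζ : E d) u ∂sphereMeasure d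
      map_add' := fun u v => by
        simp only [Submodule.coe_add, map_add, mul_add]
        refine integral_add (integrable_sphere ?_) (integrable_sphere ?_) <;>
        exact (Complex.continuous_conj.comp φ.continuous).mul (continuous_evalAt_sphere _)
      map_smul' := fun a u => by
        simp only [Submodule.coe_smul, map_smul, smul_eq_mul, mul_left_comm _ a, RingHom.id_apply]
        exact integral_const_mul _ _ }

theorem inner_harmonicProj (hd : 2 ≤ d) (m : ℕ) (φ : C(S d, ℂ)) (u : harmonicPoly d m) :
    (harmonicCore hd m).inner (harmonicProj hd m φ) u =
      ∫ ζ : S d, starRingEnd ℂ (φ ζ) * evalAt (ζ : E d) u ∂sphereMeasure d :=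
  rieszVector_spec _ _ u

theorem evalAt_harmonicProj (hd : 2 ≤ d) (m : ℕ) (φ : C(S d, ℂ)) (η : E d) :
    evalAt η (harmonicProj hd m φ : MvPolynomial (Fin d) ℂ) =
      ∫ ζ : S d, φ ζ * zonal hd m η ζ ∂sphereMeasure d := by
  rw [← inner_zonalPoly hd m η, ← (harmonicCore hd m).conj_inner_symm, inner_harmonicProj,
    ← integral_conj]
  simp [zonal_eq_evalAt, evalAt_conjPoly]

theorem integral_harmonicProj_mul (hd : 2 ≤ d) {m : ℕ} (φ : C(S d, ℂ))
    {q : MvPolynomial (Fin d) ℂ} (hq : q ∈ harmonicPoly d m) :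
    ∫ ζ : S d, evalAt (ζ : E d) (harmonicProj hd m φ : MvPolynomial (Fin d) ℂ) *
      evalAt (ζ : E d) q ∂sphereMeasure d = ∫ ζ : S d, φ ζ * evalAt (ζ : E d) q ∂sphereMeasure d := by
  have h := congrArg (starRingEnd ℂ) (inner_harmonicProj hd m φ ⟨conjPoly q, conjPoly_mem hq⟩)
  rw [harmonicCore_inner, ← integral_conj, ← integral_conj] at h
  simpa [evalAt_conjPoly] using h

/-- The spherical harmonic expansion of a continuous function converges to it when it converges
uniformly. -/
theorem tsum_harmonicProj (hd : 2 ≤ d) (φ : C(S d, ℂ)) {b : ℕ → ℝ} (hb : Summable b)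
    (h : ∀ m, ∀ ζ : S d, ‖evalAt (ζ : E d) (harmonicProj hd m φ : MvPolynomial (Fin d) ℂ)‖ ≤ b m)
    (ζ : S d) :
    ∑' m, evalAt (ζ : E d) (harmonicProj hd m φ : MvPolynomial (Fin d) ℂ) = φ ζ := by
  set Ψ : S d → ℂ := fun ζ =>
    ∑' m, evalAt (ζ : E d) (harmonicProj hd m φ : MvPolynomial (Fin d) ℂ) with hΨ
  have hΨc : Continuous Ψ := continuous_tsum (fun m => continuous_evalAt_sphere _) hb h
  suffices hz : Ψ ζ - φ ζ = 0 from sub_eq_zero.1 hz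
  refine eq_zero_of_orthogonal_harmonics (ψ := fun ζ => Ψ ζ - φ ζ) hd (hΨc.sub φ.continuous)
    (fun k q hq => ?_) ζ
  obtain ⟨B, hB0, hB⟩ := exists_bound_evalAt_sphere q
  have hqc := continuous_evalAt_sphere q
  have hiΨ : Integrable (fun ζ : S d => Ψ ζ * evalAt (ζ : E d) q) (sphereMeasure d) :=
    integrable_sphere (hΨc.mul hqc)
  have hiφ : Integrable (fun ζ : S d => φ ζ * evalAt (ζ : E d) q) (sphereMeasure d) :=
    integrable_sphere (φ.continuous.mul hqc)
  simp only [sub_mul]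
  rw [integral_sub hiΨ hiφ, sub_eq_zero]
  simp only [hΨ, ← tsum_mul_right]
  have hi : ∀ m, Integrable (fun ζ : S d => evalAt (ζ : E d)
      (harmonicProj hd m φ : MvPolynomial (Fin d) ℂ) * evalAt (ζ : E d) q) (sphereMeasure d) :=
    fun m => integrable_sphere ((continuous_evalAt_sphere _).mul hqc)
  rw [← integral_tsum_of_summable_integral_norm hi, tsum_eq_single k,
    integral_harmonicProj_mul hd φ hq]
  · exact fun m hm => sphere_integral_harmonic_mul_harmonic hd hm (Subtype.mem _) hq
  · refine Summable.of_nonneg_of_le (fun m => integral_nonneg fun ζ => norm_nonneg _)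
      (fun m => ?_) (hb.mul_right B)
    have h1 := norm_integral_le_of_norm_le_const (μ := sphereMeasure d) (C := b m * B)
      (f := fun ζ : S d => ‖evalAt (ζ : E d) (harmonicProj hd m φ : MvPolynomial (Fin d) ℂ) *
        evalAt (ζ : E d) q‖) (ae_of_all _ fun ζ => by
          rw [norm_norm, norm_mul]
          exact mul_le_mul (h m ζ) (hB ζ) (norm_nonneg _) ((norm_nonneg _).trans (h m ζ)))
    rw [measureReal_def, sphereMeasure_univ hd, ENNReal.toReal_one, mul_one] at h1
    exact (le_abs_self _).trans h1

/-- A Schwartz function is on each sphere the sum of its spherical harmonic expansion, with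
absolute convergence: the coefficients decay rapidly in the degree, while the norms of the zonal
harmonics grow polynomially. -/
theorem hasSum_zonal (hd : 2 ≤ d) (f : 𝓢(E d, ℂ)) {r : ℝ} (hr : 0 < r) (η : S d) :
    Summable (fun m => ‖∫ ζ : S d, f (r • (ζ : E d)) * zonal hd m η ζ ∂sphereMeasure d‖) ∧
    HasSum (fun m => ∫ ζ : S d, f (r • (ζ : E d)) * zonal hd m η ζ ∂sphereMeasure d)
      (f (r • (η : E d))) := by
  set φ : C(S d, ℂ) := ⟨fun ζ => f (r • (ζ : E d)), f.continuous.comp (by fun_prop)⟩ with hφ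
  -- decay of order `m ^ (2 * d)` absorbs the growth `(m + 1) ^ d` of the zonal harmonics and leaves
  -- `m ^ d`, which is at least `m ^ 2`
  obtain ⟨K, hK0, hK⟩ := exists_bound_sphere_integral hd f hr d
  obtain ⟨B, hB0, hB⟩ := exists_bound_evalAt_sphere
    (harmonicProj hd 0 φ : MvPolynomial (Fin d) ℂ)
  set b : ℕ → ℝ := fun m => if m = 0 then B else K * 2 ^ (d + 1) / (m : ℝ) ^ 2 with hbdef
  have hb : Summable b := by
    refine (summable_nat_add_iff 1).1 ?_
    have h1 : Summable fun m : ℕ => K * 2 ^ (d + 1) * (1 / (m : ℝ) ^ 2) :=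
      (Real.summable_one_div_nat_pow.2 one_lt_two).mul_left _
    refine ((summable_nat_add_iff 1).2 h1).congr fun m => ?_
    simp only [hbdef, Nat.add_eq_zero_iff, one_ne_zero, and_false, if_false]
    ring
  have hle : ∀ m, ∀ ζ : S d,
      ‖evalAt (ζ : E d) (harmonicProj hd m φ : MvPolynomial (Fin d) ℂ)‖ ≤ b m := by
    intro m ζ
    rcases Nat.eq_zero_or_pos m with rfl | hm
    · simpa [hbdef] using hB ζ
    have hm1 : (1 : ℝ) ≤ m := by exact_mod_cast hm
    have h1 := hK m _ (conjPoly_mem (zonalPoly hd m ζ).2)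
    have h2 := integral_norm_zonalPoly_le hd m ζ
    simp only [← zonal_eq_evalAt] at h1
    rw [show (∫ ζ' : S d, f (r • (ζ' : E d)) * zonal hd m ζ ζ' ∂sphereMeasure d) =
      evalAt (ζ : E d) (harmonicProj hd m φ : MvPolynomial (Fin d) ℂ) from
        (evalAt_harmonicProj hd m φ ζ).symm] at h1
    simp only [zonal_eq_evalAt, evalAt_conjPoly, RCLike.norm_conj] at h1
    have h3 : (m + 1 : ℝ) ^ d ≤ 2 ^ d * (m : ℝ) ^ d := by
      rw [← mul_pow]; gcongr; linarith
    have h4 : (m : ℝ) ^ 2 ≤ (m : ℝ) ^ d := pow_le_pow_right₀ hm1 hd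
    rw [hbdef]
    simp only [hm.ne', if_false]
    rw [le_div_iff₀ (by positivity)]
    refine le_of_mul_le_mul_left ?_ (show (0 : ℝ) < (m : ℝ) ^ d by positivity)
    set t := ‖evalAt (ζ : E d) (harmonicProj hd m φ : MvPolynomial (Fin d) ℂ)‖
    have ht : 0 ≤ t := norm_nonneg _
    calc (m : ℝ) ^ d * (t * (m : ℝ) ^ 2) ≤ (m : ℝ) ^ d * (t * (m : ℝ) ^ d) := by gcongr
      _ = (m : ℝ) ^ (2 * d) * t := by ring
      _ ≤ K * (2 * (m + 1 : ℝ) ^ d) := h1.trans (by gcongr)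
      _ ≤ K * (2 * (2 ^ d * (m : ℝ) ^ d)) := by gcongr
      _ = (m : ℝ) ^ d * (K * 2 ^ (d + 1)) := by ring
  have hev : ∀ m, (∫ ζ : S d, f (r • (ζ : E d)) * zonal hd m η ζ ∂sphereMeasure d) =
      evalAt (η : E d) (harmonicProj hd m φ : MvPolynomial (Fin d) ℂ) := fun m =>
    (evalAt_harmonicProj hd m φ η).symm
  simp only [hev]
  have hs : Summable fun m =>
      ‖evalAt (η : E d) (harmonicProj hd m φ : MvPolynomial (Fin d) ℂ)‖ :=
    Summable.of_nonneg_of_le (fun m => norm_nonneg _) (fun m => hle m η) hb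
  refine ⟨hs, ?_⟩
  have h := hs.of_norm.hasSum
  rwa [tsum_harmonicProj hd φ hb hle η] at h

theorem multiPartialD_zero (f : E d → ℂ) : multiPartialD 0 f = f := by
  unfold multiPartialD
  induction List.finRange d <;> simp

/-- The zonal components of a Schwartz function at a point sum to its value there. At the origin
only the component of degree `0` contributes. -/
theorem hasSum_sphereIntegral_zonal (hd : 2 ≤ d) (f : 𝓢(E d, ℂ)) (x : E d) :
    Summable (fun m => ‖sphereIntegral m f (fun ζ => zonal hd m x ζ) ‖x‖‖) ∧
    HasSum (fun m => sphereIntegral m f (fun ζ => zonal hd m x ζ) ‖x‖) (f x) := by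
  have hq : ∀ m, conjPoly (zonalPoly hd m x : MvPolynomial (Fin d) ℂ) ∈ harmonicPoly d m :=
    fun m => conjPoly_mem (Subtype.mem _)
  have hp : ∀ m, sphereIntegral m f (fun ζ => zonal hd m x ζ) ‖x‖ =
      profile m (conjPoly (zonalPoly hd m x : MvPolynomial (Fin d) ℂ)) f ‖x‖ := fun m => by
    simp only [profile, zonal_eq_evalAt]
  simp only [hp]
  by_cases hx : x = 0
  · subst hx
    simp only [norm_zero, profile_zero]
    have h0 : ∀ m, m ≠ 0 → ∫ ζ : S d, evalAt (ζ : E d) (taylorPoly f m) *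
        evalAt (ζ : E d) (conjPoly (zonalPoly hd m (0 : E d) : MvPolynomial (Fin d) ℂ))
          ∂sphereMeasure d = 0 := fun m hm => by
      have h1 : ∀ ζ : E d, zonal hd m 0 ζ = 0 := fun ζ => by
        have h2 := evalAt_smul ((mem_harmonicPoly _).1 (zonalPoly hd m ζ).2).1 0 0
        rw [zonal]
        simpa [hm] using h2
      simp only [← zonal_eq_evalAt, h1, mul_zero, integral_zero]
    have h1 : ∫ ζ : S d, evalAt (ζ : E d) (taylorPoly f 0) *
        evalAt (ζ : E d) (conjPoly (zonalPoly hd 0 (0 : E d) : MvPolynomial (Fin d) ℂ))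
          ∂sphereMeasure d = f 0 := by
      have h2 : ∀ ζ : E d, evalAt ζ (taylorPoly f 0) = f 0 := fun ζ => by
        simp [taylorPoly, multiPartialD_zero, evalAt_C]
      have h3 : (1 : MvPolynomial (Fin d) ℂ) ∈ harmonicPoly d 0 := by
        rw [mem_harmonicPoly]
        exact ⟨MvPolynomial.isHomogeneous_one _ _, by simp⟩
      have h4 := inner_zonalPoly hd 0 0 ⟨1, h3⟩
      rw [harmonicCore_inner] at h4
      simp only [h2, evalAt_conjPoly, integral_const_mul]
      simp only [evalAt_apply, map_one, mul_one] at h4 ⊢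
      rw [h4, mul_one]
    refine ⟨summable_of_ne_finset_zero (s := {0}) fun m hm => ?_, ?_⟩
    · rw [h0 m (by simpa using hm), norm_zero]
    · have h2 := hasSum_single (f := fun m => ∫ ζ : S d, evalAt (ζ : E d) (taylorPoly f m) *
        evalAt (ζ : E d) (conjPoly (zonalPoly hd m (0 : E d) : MvPolynomial (Fin d) ℂ))
          ∂sphereMeasure d) 0 h0
      simp only [h1] at h2
      exact h2
  · have hr : 0 < ‖x‖ := norm_pos_iff.2 hx
    have hrc : ∀ m, (‖x‖ : ℂ) ^ m ≠ 0 := fun m => pow_ne_zero _ (by exact_mod_cast hr.ne')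
    set η : S d := ⟨‖x‖⁻¹ • x, by simp [norm_smul, hr.ne']⟩ with hη
    have hxη : ‖x‖ • (η : E d) = x := by rw [hη, smul_smul, mul_inv_cancel₀ hr.ne', one_smul]
    have h1 : ∀ m, profile m (conjPoly (zonalPoly hd m x : MvPolynomial (Fin d) ℂ)) f ‖x‖ =
        ∫ ζ : S d, f (‖x‖ • (ζ : E d)) * zonal hd m η ζ ∂sphereMeasure d := fun m => by
      rw [profile_of_ne_zero ((mem_harmonicPoly _).1 (hq m)).1 f hr.ne', ← integral_const_mul]
      congr 1; ext ζ
      rw [← zonal_eq_evalAt]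
      conv_lhs => rw [zonal, ← hxη, evalAt_smul ((mem_harmonicPoly _).1 (zonalPoly hd m ζ).2).1,
        ← zonal, hxη]
      field_simp [hrc m]
    simp only [h1]
    have h2 := hasSum_zonal hd f hr η
    rwa [hxη] at h2

/-- The interpolation formula in dimension `d + 2m`, applied to the radial lift of the zonal
component of degree `m`. -/
theorem seriesTo_zonal_component (hd : 2 ≤ d) {m : ℕ} {r ρ : ℕ → ℝ} (hr : ∀ n, 0 ≤ r n)
    (hρ : ∀ n, 0 ≤ ρ n) {c c' : ℕ → ℝ → ℂ} (hc : RadialInterpolation (d + 2 * m) r ρ c c')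
    (x : E d) (f : 𝓢(E d, ℂ)) :
    SeriesTo (fun n => c n ‖x‖ * sphereIntegral m f (fun ζ => zonal hd m x ζ) (r n) +
      Complex.I ^ m * c' n ‖x‖ *
        sphereIntegral m (𝓕 f : 𝓢(E d, ℂ)) (fun ζ => zonal hd m x ζ) (ρ n))
      (sphereIntegral m f (fun ζ => zonal hd m x ζ) ‖x‖) := by
  set q := conjPoly (zonalPoly hd m x : MvPolynomial (Fin d) ℂ) with hq
  have hp : ∀ (F : 𝓢(E d, ℂ)) (t : ℝ),
      sphereIntegral m F (fun ζ => zonal hd m x ζ) t = profile m q F t := fun F t => by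
    simp only [profile, zonal_eq_evalAt, hq]
  simp only [hp]
  obtain ⟨g, hg, hg'⟩ := exists_schwartz_radialLift hd (conjPoly_mem (Subtype.mem _) :
    q ∈ harmonicPoly d m) f
  have hax : ∀ t : ℝ, 0 ≤ t → ‖axisPoint (d + 2 * m) t‖ = t := fun t =>
    norm_axisPoint (by omega)
  have hgr : IsRadial g := fun y z hyz => by simp only [hg, radialLift, hyz]
  obtain ⟨A, B, hA, hB, hAB⟩ := hc g hgr (axisPoint (d + 2 * m) ‖x‖)
  rw [hg, radialLift, hax _ (norm_nonneg x)] at hAB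
  rw [hAB]
  simp only [hax _ (norm_nonneg x), radialValue, hg, hg', radialLift, hax _ (hr _),
    hax _ (hρ _)] at hA hB
  refine (hA.add hB).congr fun N => ?_
  rw [← Finset.sum_add_distrib]
  exact Finset.sum_congr rfl fun n _ => by ring

end RadialInterp

end

theorem mainTheorem6 (d : ℕ) (hd : 2 ≤ d) (r ρ : ℕ → ℝ)
    (hr : ∀ n, 0 ≤ r n) (hρ : ∀ n, 0 ≤ ρ n) (c c' : ℕ → ℕ → ℝ → ℂ)
    (hc : ∀ m : ℕ, RadialInterp.RadialInterpolation (d + 2 * m) r ρ (c (d + 2 * m)) (c' (d + 2 * m)))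
    (x : RadialInterp.E d) (f : 𝓢(RadialInterp.E d, ℂ)) :
    ∃ s : ℕ → ℂ,
      (∀ m : ℕ, RadialInterp.SeriesTo (fun n =>
        c (d + 2 * m) n ‖x‖ *
            RadialInterp.sphereIntegral m f (fun ζ => RadialInterp.zonal hd m x ζ) (r n) +
          Complex.I ^ m * c' (d + 2 * m) n ‖x‖ *
            RadialInterp.sphereIntegral m (𝓕 f : 𝓢(RadialInterp.E d, ℂ))
              (fun ζ => RadialInterp.zonal hd m x ζ) (ρ n)) (s m)) ∧
      Summable (fun m => ‖s m‖) ∧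
      RadialInterp.SeriesTo s (f x) := by
  obtain ⟨h1, h2⟩ := RadialInterp.hasSum_sphereIntegral_zonal hd f x
  exact ⟨fun m => RadialInterp.sphereIntegral m f (fun ζ => RadialInterp.zonal hd m x ζ) ‖x‖,
    fun m => RadialInterp.seriesTo_zonal_component hd hr hρ (hc m) x f, h1, h2.tendsto_sum_nat⟩
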